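/- Theorem 5.3 (thm:nucu). There is a commutative unital $C^*$-algebra that is computably presentable but not uniformly computably unital. Specifically, for $n \in \mathbb{N}$ let $J_n = [2^{-n} - 2^{-(n+2)},\, 2^{-n} + 2^{-(n+2)}]$, let $X = \{0\} \cup \bigcup_{n} J_n \subseteq \mathbb{R}$, and let $C^*(X)$ be the $C^*$-algebra of continuous functions $X \to \mathbb{C}$ with the supremum norm. Then $C^*(X)$ is such an algebra. Here the following terminology is used. Let $A$ be a $C^*$-algebra. A presentation of $A$ is a pair $A^\# = (A, (u_n)_{n \in \mathbb{N}})$ where the sequence $(u_n)_{n \in \mathbb{N}}$ generates $A$ as a $C^*$-algebra. Let $(\mathfrak{p}_n)_{n \in \mathbb{N}}$ be a fixed effective enumeration of the rational $*$-polynomials, that is, the noncommutative polynomials without constant term in $x_0, x_0^*, x_1, x_1^*, \ldots$ with coefficients in $\mathbb{Q}(i)$, and let $\mathfrak{p}_n[A^\#]$ be the vector obtained from $\mathfrak{p}_n$ by substituting $u_j$ for $x_j$ for every $j$. A name of $A^\#$ is a function $f : \mathbb{N} \to \mathbb{N}$ that enumerates (codes of) the elements of $$D(A^\#) = \{(r,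 j, r') : r, r' \in \mathbb{Q} \cap (0, \infty),\ r < \|\mathfrak{p}_j[A^\#]\| < r'\}.$$ The presentation $A^\#$ is computable if it has a computable name, and an index of $A^\#$ is an index $e$ of a (total) computable function $\phi_e$ that is a name of $A^\#$. The algebra $A$ is computably presentable if it has a computable presentation. An $A^\#$-index of a vector $v \in A$ is an index $i$ of a total computable function $\phi_i$ such that $\|\mathfrak{p}_{\phi_i(k)}[A^\#] - v\| < 2^{-k}$ for all $k \in \mathbb{N}$. A unital $C^*$-algebra $A$ with unit $\mathbf{1}_A$ is uniformly computably unital if there is a partial computable function $\psi$ such that, whenever $e$ is an index of a presentation $A^\#$ of $A$, $\psi(e)$ is defined and is an $A^\#$-index of $\mathbf{1}_A$. -/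

import Mathlib

/-! ### The space -/

/-- The interval `J_n = [2⁻ⁿ - 2⁻⁽ⁿ⁺²⁾, 2⁻ⁿ + 2⁻⁽ⁿ⁺²⁾]`. -/
def shrinkingInterval (n : ℕ) : Set ℝ :=
  Set.Icc ((1 / 2 : ℝ) ^ n - (1 / 2 : ℝ) ^ (n + 2)) ((1 / 2 : ℝ) ^ n + (1 / 2 : ℝ) ^ (n + 2))

/-- The space `X = {0} ∪ ⋃ₙ J_n`, as a subset of the real line. -/
def shrinkingIntervals : Set ℝ :=
  {0} ∪ ⋃ n, shrinkingInterval n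

theorem isCompact_shrinkingIntervals : IsCompact shrinkingIntervals := by
  have hlim : Filter.Tendsto (fun n : ℕ => 2 * (1 / 2 : ℝ) ^ n) Filter.atTop (nhds 0) := by
    have h := tendsto_pow_atTop_nhds_zero_of_lt_one (r := (1 / 2 : ℝ)) (by norm_num) (by norm_num)
    simpa using h.const_mul 2
  rw [isCompact_iff_ultrafilter_le_nhds]
  intro f hf
  rw [Filter.le_principal_iff] at hf
  by_cases h : ∃ N : ℕ, (⋃ n ∈ Finset.range N, shrinkingInterval n) ∈ f
  · obtain ⟨N, hN⟩ := h
    have hc : IsCompact (⋃ n ∈ Finset.range N, shrinkingInterval n) :=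
      (Finset.range N).isCompact_biUnion fun n _ => isCompact_Icc
    obtain ⟨x, hx, hfx⟩ := isCompact_iff_ultrafilter_le_nhds.1 hc f (Filter.le_principal_iff.2 hN)
    refine ⟨x, Or.inr ?_, hfx⟩
    simp only [Set.mem_iUnion] at hx ⊢
    obtain ⟨n, _, hn⟩ := hx
    exact ⟨n, hn⟩
  · push Not at h
    refine ⟨0, Or.inl rfl, ?_⟩
    intro s hs
    obtain ⟨ε, hε, hεs⟩ := Metric.mem_nhds_iff.1 hs
    obtain ⟨N, hN⟩ := (hlim.eventually (gt_mem_nhds hε)).exists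
    have hN' := Ultrafilter.compl_mem_iff_notMem.2 (h N)
    filter_upwards [hf, hN'] with x hx hxN
    apply hεs
    rw [Metric.mem_ball, Real.dist_eq, sub_zero]
    rcases hx with hx | hx
    · rw [Set.mem_singleton_iff.1 hx]
      simpa using hε
    · obtain ⟨n, hn⟩ := Set.mem_iUnion.1 hx
      have hnN : N ≤ n := by
        by_contra hlt
        exact hxN (Set.mem_biUnion (Finset.mem_coe.2 (Finset.mem_range.2 (not_le.1 hlt))) hn)
      have hpow : (1 / 2 : ℝ) ^ n ≤ (1 / 2 : ℝ) ^ N :=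
        pow_le_pow_of_le_one (by norm_num) (by norm_num) hnN
      have hpos : (0 : ℝ) < (1 / 2 : ℝ) ^ n := by positivity
      obtain ⟨h1, h2⟩ := hn
      rw [pow_add] at h1 h2
      rw [abs_lt]
      constructor <;> linarith

instance : CompactSpace shrinkingIntervals :=
  isCompact_iff_compactSpace.1 isCompact_shrinkingIntervals

/-! ### Rational star-polynomials and their effective enumeration -/

/-- Codes of rational numbers: `(a, b, c)` is a code of `(a - b) / (c + 1)`. -/
abbrev RatCode : Type := ℕ × ℕ × ℕ

def RatCode.toRat (q : RatCode) : ℚ :=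
  ((q.1 : ℚ) - (q.2.1 : ℚ)) / ((q.2.2 : ℚ) + 1)

/-- A letter: `inl j` is the indeterminate `x_j`, and `inr j` is its adjoint `x_j^*`. -/
abbrev StarLetter : Type := ℕ ⊕ ℕ

/-- A monomial `(c, l, w)` with coefficient `c` (real and imaginary part, both rational) and
with the nonempty word `l w` of letters. Words are nonempty, so there is no constant term. -/
abbrev RatStarMonomial : Type := (RatCode × RatCode) × StarLetter × List StarLetter

/-- Rational (noncommutative) star-polynomials without constant term, in the indeterminates
`x_0, x_1, …`: finite formal sums of monomials. -/
abbrev RatStarPoly : Type := List RatStarMonomial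

/-- The effective enumeration of the rational star-polynomials. -/
def ratStarPoly (n : ℕ) : RatStarPoly := Denumerable.ofNat RatStarPoly n

section Eval

variable {A : Type*} [NonUnitalCStarAlgebra A]

def StarLetter.eval (u : ℕ → A) : StarLetter → A
  | Sum.inl j => u j
  | Sum.inr j => star (u j)

noncomputable def RatStarMonomial.eval (u : ℕ → A) (m : RatStarMonomial) : A :=
  (⟨(m.1.1.toRat : ℝ), (m.1.2.toRat : ℝ)⟩ : ℂ) •
    m.2.2.foldl (fun a l => a * StarLetter.eval u l) (StarLetter.eval u m.2.1)

noncomputable def RatStarPoly.eval (u : ℕ → A) (p : RatStarPoly) : A :=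
  (p.map (RatStarMonomial.eval u)).sum

end Eval

/-! ### Presentations of C*-algebras -/

/-- A presentation of a C*-algebra `A`: a sequence of distinguished vectors that generates `A` as
a C*-algebra. -/
structure CStarPresentation (A : Type*) [NonUnitalCStarAlgebra A] where
  vec : ℕ → A
  dense_adjoin : Dense (NonUnitalStarAlgebra.adjoin ℂ (Set.range vec) : Set A)

namespace CStarPresentation

variable {A : Type*} [NonUnitalCStarAlgebra A]

/-- The `n`-th rational vector of the presentation. -/
noncomputable def ratVec (P : CStarPresentation A) (n : ℕ) : A :=
  RatStarPoly.eval P.vec (ratStarPoly n)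

/-- The diagram: all `(r, j, r')` with `r, r'` positive rationals and `r < ‖𝔭_j‖ < r'`. -/
def diagram (P : CStarPresentation A) : Set (ℚ × ℕ × ℚ) :=
  {t | 0 < t.1 ∧ 0 < t.2.2 ∧ (t.1 : ℝ) < ‖P.ratVec t.2.1‖ ∧ ‖P.ratVec t.2.1‖ < (t.2.2 : ℝ)}

/-- The triple `(r, j, r')` that is coded by a natural number. -/
def decodeTriple (n : ℕ) : ℚ × ℕ × ℚ :=
  let t := Denumerable.ofNat (RatCode × ℕ × RatCode) n
  (t.1.toRat, t.2.1, t.2.2.toRat)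

/-- `f` is a name of the presentation: it enumerates (codes of) the elements of the diagram. -/
def IsName (P : CStarPresentation A) (f : ℕ → ℕ) : Prop :=
  P.diagram = {t | ∃ k, decodeTriple (f k) = t}

/-- A presentation is computable if it has a computable name. -/
def IsComputable (P : CStarPresentation A) : Prop :=
  ∃ f : ℕ → ℕ, Computable f ∧ P.IsName f

/-- The program `e` is an index of the presentation: it computes a name of it. -/
def IsIndex (P : CStarPresentation A) (e : Nat.Partrec.Code) : Prop :=
  ∃ f : ℕ → ℕ, (∀ k, e.eval k = Part.some (f k)) ∧ P.IsName f

/-- The program `i` is an index of the vector `v` with respect to the presentation: on input `k` it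
halts and gives the number of a rational vector whose distance to `v` is less than `2⁻ᵏ`. -/
def IsVecIndex (P : CStarPresentation A) (v : A) (i : Nat.Partrec.Code) : Prop :=
  ∀ k : ℕ, ∃ n ∈ i.eval k, ‖P.ratVec n - v‖ < (1 / 2 : ℝ) ^ k

end CStarPresentation

/-- `A` has a computable presentation. -/
def ComputablyPresentable (A : Type*) [NonUnitalCStarAlgebra A] : Prop :=
  ∃ P : CStarPresentation A, P.IsComputable

/-- There is an algorithm that, given an index of a presentation of `A`, computes an index of the
unit of `A` with respect to that presentation. -/
def UniformlyComputablyUnital (A : Type*) [CStarAlgebra A] : Prop :=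
  ∃ ψ : Nat.Partrec.Code →. Nat.Partrec.Code, Partrec ψ ∧
    ∀ (P : CStarPresentation A) (e : Nat.Partrec.Code), P.IsIndex e →
      ∃ i ∈ ψ e, P.IsVecIndex 1 i

/-! ### Arithmetic on codes of rational numbers -/

/-! The proof diagonalizes against a supposed algorithm `ψ` by the recursion theorem. On every piece
numbered `k ≥ 1`, generator `0` is the unit and generator `k` is a coordinate with range `[3/4,
5/4]`. On piece `0`, generator `0` vanishes and generator `i + 1` is the coordinate exactly when `T
i` holds. If `T` is identically false, piece `0` carries only zeros and does not affect norms, so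
the same enumeration `diagramEnum T` names the presentation in which the intervals are the pieces
`1, 2, …` (`d = 1`). If some `T i` holds, it names the presentation in which `J_0` is piece `0` (`d
= 0`). Thus a single program can postpone deciding whether piece `0` exists
(`isName_piecePresentation`).

Let `e` enumerate `diagramEnum T`, where `T` watches `ψ e` and the index that it returns run on
input `1`, and becomes true only at stages not below the output `n`. If `T` stays false, `e` is an
index of the presentation with `d = 1`, so `ψ` has to answer and `T` becomes true after all. If `T`
becomes true, `e` is an index of the presentation with `d = 0`, but the `n`-th polynomial uses only
generators that vanish on `J_0`, so its value is at distance at least `1` from the unit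
(`one_le_norm_ratVec_sub_one`).

Two facts support this. The diagram is enumerable uniformly in `T` (`exists_diagramTest_iff`),
because the `n`-th polynomial sees only finitely many pieces, on each of which it is a polynomial in
one bounded variable. The generators do generate the algebra (`dense_adjoin_generator`), by
Stone–Weierstrass and because a nonunital algebra with an element close to the unit has the unit in
its closure. -/

namespace RatCode

/-- The last component stores the denominator minus one, and `c * c' + c + c'` is `(c + 1) * (c' +
1) - 1`. -/
def add (p q : RatCode) : RatCode :=
  (p.1 * (q.2.2 + 1) + q.1 * (p.2.2 + 1), p.2.1 * (q.2.2 + 1) + q.2.1 * (p.2.2 + 1),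
    p.2.2 * q.2.2 + p.2.2 + q.2.2)

def mul (p q : RatCode) : RatCode :=
  (p.1 * q.1 + p.2.1 * q.2.1, p.1 * q.2.1 + p.2.1 * q.1, p.2.2 * q.2.2 + p.2.2 + q.2.2)

def Lt (p q : RatCode) : Prop :=
  p.1 * (q.2.2 + 1) + q.2.1 * (p.2.2 + 1) < q.1 * (p.2.2 + 1) + p.2.1 * (q.2.2 + 1)

theorem toRat_add (p q : RatCode) : (add p q).toRat = p.toRat + q.toRat := by
  have hp : (p.2.2 : ℚ) + 1 ≠ 0 := by positivity
  have hq : (q.2.2 : ℚ) + 1 ≠ 0 := by positivity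
  have hpq : (p.2.2 : ℚ) * q.2.2 + p.2.2 + q.2.2 + 1 ≠ 0 := by positivity
  simp only [toRat, add]
  push_cast
  field_simp
  ring

theorem toRat_mul (p q : RatCode) : (mul p q).toRat = p.toRat * q.toRat := by
  have hp : (p.2.2 : ℚ) + 1 ≠ 0 := by positivity
  have hq : (q.2.2 : ℚ) + 1 ≠ 0 := by positivity
  have hpq : (p.2.2 : ℚ) * q.2.2 + p.2.2 + q.2.2 + 1 ≠ 0 := by positivity
  simp only [toRat, mul]
  push_cast
  field_simp
  ring

theorem lt_iff (p q : RatCode) : Lt p q ↔ p.toRat < q.toRat := by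
  have hp : (0 : ℚ) < (p.2.2 : ℚ) + 1 := by positivity
  have hq : (0 : ℚ) < (q.2.2 : ℚ) + 1 := by positivity
  rw [toRat, toRat, div_lt_div_iff₀ hp hq, Lt, ← Nat.cast_lt (α := ℚ)]
  push_cast
  constructor <;> intro h <;> linarith

theorem primrec_add : Primrec₂ add := by
  have a := Primrec.fst.comp (Primrec.fst (α := RatCode) (β := RatCode))
  have b := Primrec.fst.comp (Primrec.snd.comp (Primrec.fst (α := RatCode) (β := RatCode)))
  have c := Primrec.snd.comp (Primrec.snd.comp (Primrec.fst (α := RatCode) (β := RatCode)))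
  have a' := Primrec.fst.comp (Primrec.snd (α := RatCode) (β := RatCode))
  have b' := Primrec.fst.comp (Primrec.snd.comp (Primrec.snd (α := RatCode) (β := RatCode)))
  have c' := Primrec.snd.comp (Primrec.snd.comp (Primrec.snd (α := RatCode) (β := RatCode)))
  exact (Primrec.nat_add.comp (Primrec.nat_mul.comp a (Primrec.succ.comp c'))
      (Primrec.nat_mul.comp a' (Primrec.succ.comp c))).pair
    ((Primrec.nat_add.comp (Primrec.nat_mul.comp b (Primrec.succ.comp c'))
      (Primrec.nat_mul.comp b' (Primrec.succ.comp c))).pair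
    (Primrec.nat_add.comp (Primrec.nat_add.comp (Primrec.nat_mul.comp c c') c) c'))

theorem primrec_mul : Primrec₂ mul := by
  have a := Primrec.fst.comp (Primrec.fst (α := RatCode) (β := RatCode))
  have b := Primrec.fst.comp (Primrec.snd.comp (Primrec.fst (α := RatCode) (β := RatCode)))
  have c := Primrec.snd.comp (Primrec.snd.comp (Primrec.fst (α := RatCode) (β := RatCode)))
  have a' := Primrec.fst.comp (Primrec.snd (α := RatCode) (β := RatCode))
  have b' := Primrec.fst.comp (Primrec.snd.comp (Primrec.snd (α := RatCode) (β := RatCode)))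
  have c' := Primrec.snd.comp (Primrec.snd.comp (Primrec.snd (α := RatCode) (β := RatCode)))
  exact (Primrec.nat_add.comp (Primrec.nat_mul.comp a a') (Primrec.nat_mul.comp b b')).pair
    ((Primrec.nat_add.comp (Primrec.nat_mul.comp a b') (Primrec.nat_mul.comp b a')).pair
    (Primrec.nat_add.comp (Primrec.nat_add.comp (Primrec.nat_mul.comp c c') c) c'))

theorem primrecRel_lt : PrimrecRel Lt := by
  have a := Primrec.fst.comp (Primrec.fst (α := RatCode) (β := RatCode))
  have b := Primrec.fst.comp (Primrec.snd.comp (Primrec.fst (α := RatCode) (β := RatCode)))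
  have c := Primrec.snd.comp (Primrec.snd.comp (Primrec.fst (α := RatCode) (β := RatCode)))
  have a' := Primrec.fst.comp (Primrec.snd (α := RatCode) (β := RatCode))
  have b' := Primrec.fst.comp (Primrec.snd.comp (Primrec.snd (α := RatCode) (β := RatCode)))
  have c' := Primrec.snd.comp (Primrec.snd.comp (Primrec.snd (α := RatCode) (β := RatCode)))
  exact Primrec.nat_lt.comp
    (Primrec.nat_add.comp (Primrec.nat_mul.comp a (Primrec.succ.comp c'))
      (Primrec.nat_mul.comp b' (Primrec.succ.comp c)))
    (Primrec.nat_add.comp (Primrec.nat_mul.comp a' (Primrec.succ.comp c))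
      (Primrec.nat_mul.comp b (Primrec.succ.comp c')))

end RatCode

/-! ### Values of words and bounds for values of polynomials -/

/-- The value of the `j`-th generator on the `k`-th piece, out of `zero`, `one` and the coordinate
`t` of the piece. On the pieces `k ≥ 1` the generator `0` is the unit and the generator `k` is the
coordinate; on the piece `0` the generator `j + 1` is the coordinate whenever `T j` holds. -/
def pieceValue {R : Type*} (T : ℕ → Bool) (k j : ℕ) (zero one t : R) : R :=
  if j = 0 then (if k = 0 then zero else one)
  else if k = j then t
  else if k = 0 then (bif T (j - 1) then t else zero)
  else zero

theorem map_pieceValue {R S : Type*} (f : R → S) (T : ℕ → Bool) (k j : ℕ) (zero one t : R) :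
    f (pieceValue T k j zero one t) = pieceValue T k j (f zero) (f one) (f t) := by
  unfold pieceValue
  split_ifs <;> first | rfl | (cases T (j - 1) <;> rfl)

def StarLetter.index (l : StarLetter) : ℕ := Sum.elim id id l

abbrev StarWord : Type := StarLetter × List StarLetter

noncomputable def wordValue (v : ℕ → ℝ) (w : StarWord) : ℝ :=
  w.2.foldl (fun x l => x * v l.index) (v w.1.index)

def wordCode (v : ℕ → RatCode) (w : StarWord) : RatCode :=
  w.2.foldl (fun x l => x.mul (v l.index)) (v w.1.index)

/-- An expression in two assignments that for equal assignments is the value of the polynomial with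
real coefficients `q`, and that is antitone in the first and monotone in the second assignment. -/
noncomputable def polyBound (v v' : ℕ → ℝ) (q : List (RatCode × StarWord)) : ℝ :=
  (q.map fun m => ((m.1.1 : ℝ) * wordValue v' m.2 - m.1.2.1 * wordValue v m.2) /
    (m.1.2.2 + 1)).sum

def polyBoundCode (v v' : ℕ → RatCode) (q : List (RatCode × StarWord)) : RatCode :=
  q.foldr (fun m x => RatCode.add (RatCode.mul (m.1.1, 0, m.1.2.2) (wordCode v' m.2))
    (RatCode.add (RatCode.mul (0, m.1.2.1, m.1.2.2) (wordCode v m.2)) x)) (0, 0, 0)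

theorem toRat_wordCode (v : ℕ → RatCode) (w : StarWord) :
    ((wordCode v w).toRat : ℝ) = wordValue (fun j => ((v j).toRat : ℝ)) w := by
  obtain ⟨l, w⟩ := w
  have h : ∀ (w : List StarLetter) (x : RatCode),
      ((w.foldl (fun x l => x.mul (v l.index)) x).toRat : ℝ) =
        w.foldl (fun x l => x * ((v l.index).toRat : ℝ)) (x.toRat : ℝ) := by
    intro w
    induction w with
    | nil => intro x; rfl
    | cons a w ih =>
      intro x
      rw [List.foldl_cons, List.foldl_cons, ih, RatCode.toRat_mul]
      push_cast
      rfl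
  exact h w _

theorem toRat_polyBoundCode (v v' : ℕ → RatCode) (q : List (RatCode × StarWord)) :
    ((polyBoundCode v v' q).toRat : ℝ) =
      polyBound (fun j => ((v j).toRat : ℝ)) (fun j => ((v' j).toRat : ℝ)) q := by
  induction q with
  | nil => simp [polyBoundCode, polyBound, RatCode.toRat]
  | cons m q ih =>
    simp only [polyBoundCode, polyBound, List.foldr_cons, List.map_cons, List.sum_cons] at ih ⊢
    rw [RatCode.toRat_add, RatCode.toRat_mul, RatCode.toRat_add, RatCode.toRat_mul]
    push_cast
    rw [ih, toRat_wordCode, toRat_wordCode]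
    simp only [RatCode.toRat]
    push_cast
    ring

/-- Products of nonnegative factors are monotone. As both parts of a coefficient's numerator are
natural numbers, this is all that the interval bounds for polynomials need. -/
theorem wordValue_mono {v v' : ℕ → ℝ} (hv : ∀ j, 0 ≤ v j) (h : ∀ j, v j ≤ v' j) (w : StarWord) :
    wordValue v w ≤ wordValue v' w := by
  obtain ⟨l, w⟩ := w
  have hfold : ∀ (w : List StarLetter) (x x' : ℝ), 0 ≤ x → x ≤ x' →
      w.foldl (fun x l => x * v l.index) x ≤ w.foldl (fun x l => x * v' l.index) x' := by
    intro w
    induction w with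
    | nil => intro x x' _ hx; exact hx
    | cons a w ih =>
      intro x x' h0 hx
      exact ih _ _ (mul_nonneg h0 (hv _)) (mul_le_mul hx (h _) (hv _) (h0.trans hx))
  exact hfold w _ _ (hv _) (h _)

theorem polyBound_mono {u u' v v' : ℕ → ℝ} (hu : ∀ j, 0 ≤ u j) (hu' : ∀ j, 0 ≤ u' j)
    (h : ∀ j, u j ≤ v j) (h' : ∀ j, u' j ≤ v' j) (q : List (RatCode × StarWord)) :
    polyBound v u' q ≤ polyBound u v' q := by
  refine List.sum_le_sum fun m _ => ?_
  have := wordValue_mono hu h m.2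
  have := wordValue_mono hu' h' m.2
  gcongr

theorem continuous_wordValue {Y : Type*} [TopologicalSpace Y] {v : Y → ℕ → ℝ}
    (hv : ∀ j, Continuous fun y => v y j) (w : StarWord) : Continuous fun y => wordValue (v y) w := by
  obtain ⟨l, w⟩ := w
  have h : ∀ (w : List StarLetter) (f : Y → ℝ), Continuous f →
      Continuous fun y => w.foldl (fun x l => x * v y l.index) (f y) := by
    intro w
    induction w with
    | nil => intro f hf; exact hf
    | cons a w ih => intro f hf; exact ih _ (hf.mul (hv _))
  exact h w _ (hv _)

theorem continuous_polyBound {Y : Type*} [TopologicalSpace Y] {v v' : Y → ℕ → ℝ}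
    (hv : ∀ j, Continuous fun y => v y j) (hv' : ∀ j, Continuous fun y => v' y j)
    (q : List (RatCode × StarWord)) : Continuous fun y => polyBound (v y) (v' y) q := by
  refine continuous_list_sum _ fun m _ => ?_
  exact (((continuous_wordValue hv' _).const_mul _).sub
    ((continuous_wordValue hv _).const_mul _)).div_const _

def RatStarPoly.rePart (p : RatStarPoly) : List (RatCode × StarWord) :=
  p.map fun m => (m.1.1, m.2)

def RatStarPoly.imPart (p : RatStarPoly) : List (RatCode × StarWord) :=
  p.map fun m => (m.1.2, m.2)

/-- At real values `x_j` and `x_j^*` agree and words are real, so the coefficients alone separate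
real and imaginary parts. -/
theorem RatStarPoly.eval_ofReal (v : ℕ → ℝ) (p : RatStarPoly) :
    RatStarPoly.eval (fun j => (v j : ℂ)) p =
      ⟨polyBound v v p.rePart, polyBound v v p.imPart⟩ := by
  have hl : ∀ l : StarLetter, StarLetter.eval (fun j => (v j : ℂ)) l = (v l.index : ℂ) := by
    rintro (j | j)
    · rfl
    · exact Complex.conj_ofReal _
  have hw : ∀ (w : List StarLetter) (x : ℝ),
      w.foldl (fun a l => a * StarLetter.eval (fun j => (v j : ℂ)) l) (x : ℂ) =
        ((w.foldl (fun x l => x * v l.index) x : ℝ) : ℂ) := by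
    intro w
    induction w with
    | nil => intro x; rfl
    | cons a w ih => intro x; rw [List.foldl_cons, List.foldl_cons, hl, ← Complex.ofReal_mul, ih]
  induction p with
  | nil => simp [RatStarPoly.eval, polyBound, rePart, imPart, Complex.ext_iff]
  | cons m p ih =>
    have h1 : RatStarPoly.eval (fun j => (v j : ℂ)) (m :: p) =
        RatStarMonomial.eval (fun j => (v j : ℂ)) m + RatStarPoly.eval (fun j => (v j : ℂ)) p := by
      simp [RatStarPoly.eval]
    have h2 : RatStarMonomial.eval (fun j => (v j : ℂ)) m =
        (⟨(m.1.1.toRat : ℝ), (m.1.2.toRat : ℝ)⟩ : ℂ) * (wordValue v m.2 : ℂ) := by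
      rw [RatStarMonomial.eval, hl, hw]
      rfl
    rw [h1, h2, ih]
    apply Complex.ext
    · simp only [polyBound, rePart, List.map_cons, List.sum_cons, RatCode.toRat, Complex.add_re,
        Complex.mul_re, Complex.ofReal_re, Complex.ofReal_im]
      push_cast
      ring
    · simp only [polyBound, imPart, List.map_cons, List.sum_cons, RatCode.toRat, Complex.add_im,
        Complex.mul_im, Complex.ofReal_re, Complex.ofReal_im]
      push_cast
      ring

/-! ### Indices of letters -/

theorem Encodable.encode_le_encode_list {α : Type*} [Encodable α] {a : α} {l : List α}
    (h : a ∈ l) : Encodable.encode a ≤ Encodable.encode l := by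
  induction l with
  | nil => simp at h
  | cons b l ih =>
    rw [Encodable.encode_list_cons]
    rcases List.mem_cons.1 h with rfl | h
    · exact (Nat.left_le_pair _ _).trans (Nat.le_succ _)
    · exact ((ih h).trans (Nat.right_le_pair _ _)).trans (Nat.le_succ _)

theorem StarLetter.index_le_encode (l : StarLetter) : l.index ≤ Encodable.encode l := by
  rcases l with j | j
  · rw [Encodable.encode_inl]
    simp only [StarLetter.index, Sum.elim_inl, id, Encodable.encode_nat]
    omega
  · rw [Encodable.encode_inr]
    simp only [StarLetter.index, Sum.elim_inr, id, Encodable.encode_nat]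
    omega

/-- The pairing function dominates its arguments, so a code bounds every index inside it. This makes
the relevant pieces finite in number, and it lets the diagonalization use generators beyond the
reach of a given polynomial. -/
theorem index_le_of_mem_ratStarPoly {n : ℕ} {m : RatStarMonomial} (hm : m ∈ ratStarPoly n) :
    m.2.1.index ≤ n ∧ ∀ l ∈ m.2.2, l.index ≤ n := by
  have h := Encodable.encode_le_encode_list hm
  rw [ratStarPoly, Denumerable.encode_ofNat] at h
  obtain ⟨c, l, w⟩ := m
  simp only [Encodable.encode_prod_val] at h
  have h1 := (Nat.right_le_pair _ _).trans h
  refine ⟨(l.index_le_encode.trans (Nat.left_le_pair _ _)).trans h1, fun l' hl' => ?_⟩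
  exact ((l'.index_le_encode.trans (Encodable.encode_le_encode_list hl')).trans
    (Nat.right_le_pair _ _)).trans h1

/-! ### The decidable test for membership in the diagram -/

/-- The `a`-th point of the subdivision of `[3/4, 5/4]` into `N + 1` parts. -/
def meshPoint (N a : ℕ) : RatCode := (3 * (N + 1) + 2 * a, 0, 4 * N + 3)

/-- Squared norms keep the test within rational arithmetic. The two pairs in `s` serve the real and
the imaginary part; each holds the coordinate for the antitone and for the monotone slot of
`polyBound`. -/
def normSqCode (T : ℕ → Bool) (k : ℕ) (s : (RatCode × RatCode) × RatCode × RatCode)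
    (p : RatStarPoly) : RatCode :=
  let v (t : RatCode) (j : ℕ) : RatCode := pieceValue T k j (0, 0, 0) (1, 0, 0) t
  let x := polyBoundCode (v s.1.1) (v s.1.2) p.rePart
  let y := polyBoundCode (v s.2.1) (v s.2.2) p.imPart
  (x.mul x).add (y.mul y)

def LowerTest (T : ℕ → Bool) (r : RatCode) (n k N a : ℕ) : Prop :=
  (r.mul r).Lt (normSqCode T k
    ((meshPoint N a, meshPoint N a), meshPoint N a, meshPoint N a) (ratStarPoly n))

/-- The order of the endpoints decides whether `polyBound` bounds from above or from below. Both are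
needed for each part, since a square is controlled only by a two-sided bound. -/
def UpperTest (T : ℕ → Bool) (r : RatCode) (n k N a : ℕ) : Prop :=
  (∀ s ∈ [(meshPoint N a, meshPoint N (a + 1)), (meshPoint N (a + 1), meshPoint N a)],
    ∀ s' ∈ [(meshPoint N a, meshPoint N (a + 1)), (meshPoint N (a + 1), meshPoint N a)],
      (normSqCode T k (s, s') (ratStarPoly n)).Lt (r.mul r))

/-- The test, with precision `N`, for the triple `(r, j, r')` to belong to the diagram. -/
def DiagramTest (T : ℕ → Bool) (c : RatCode × ℕ × RatCode) (N : ℕ) : Prop :=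
  (RatCode.Lt (0, 0, 0) c.1 ∧ RatCode.Lt (0, 0, 0) c.2.2) ∧
    (∃ k < c.2.1 + 2, ∃ a < N + 2, LowerTest T c.1 c.2.1 k N a) ∧
    ∀ k < c.2.1 + 2, ∀ a < N + 1, UpperTest T c.2.2 c.2.1 k N a

/-! ### Primitive recursiveness of the test, uniformly in a parameter on which `T` depends -/

section Primrec

variable {α : Type*} [Primcodable α]

theorem PrimrecRel.exists_lt_of {R : ℕ → α → Prop} (hR : PrimrecRel R) {f : α → ℕ}
    (hf : Primrec f) : PrimrecPred fun x => ∃ k < f x, R k x :=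
  (hR.exists_mem_list.comp (Primrec.list_range.comp hf) Primrec.id).of_eq fun x => by simp

theorem PrimrecRel.forall_lt_of {R : ℕ → α → Prop} (hR : PrimrecRel R) {f : α → ℕ}
    (hf : Primrec f) : PrimrecPred fun x => ∀ k < f x, R k x :=
  (hR.forall_mem_list.comp (Primrec.list_range.comp hf) Primrec.id).of_eq fun x => by simp

theorem primrec_starLetter_index : Primrec StarLetter.index :=
  (Primrec.sumCasesOn Primrec.id Primrec₂.right Primrec₂.right).of_eq fun l => by
    cases l <;> rfl

theorem primrec_wordCode {v : α → ℕ → RatCode} (hv : Primrec₂ v) :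
    Primrec₂ fun a w => wordCode (v a) w := by
  refine Primrec.list_foldl (α := α × StarWord)
    (f := fun x => x.2.2) (g := fun x => v x.1 x.2.1.index)
    (h := fun x y => y.1.mul (v x.1 y.2.index)) (Primrec.snd.comp Primrec.snd)
    (hv.comp Primrec.fst (primrec_starLetter_index.comp (Primrec.fst.comp Primrec.snd))) ?_
  exact RatCode.primrec_mul.comp (Primrec.fst.comp Primrec.snd)
    (hv.comp (Primrec.fst.comp Primrec.fst)
      (primrec_starLetter_index.comp (Primrec.snd.comp Primrec.snd)))

theorem primrec_polyBoundCode {v v' : α → ℕ → RatCode} (hv : Primrec₂ v) (hv' : Primrec₂ v') :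
    Primrec₂ fun a q => polyBoundCode (v a) (v' a) q := by
  refine Primrec.list_foldr (α := α × List (RatCode × StarWord))
    (f := fun x => x.2) (g := fun _ => ((0, 0, 0) : RatCode))
    (h := fun x y => RatCode.add (RatCode.mul (y.1.1.1, 0, y.1.1.2.2) (wordCode (v' x.1) y.1.2))
      (RatCode.add (RatCode.mul (0, y.1.1.2.1, y.1.1.2.2) (wordCode (v x.1) y.1.2)) y.2))
    Primrec.snd (Primrec.const _) ?_
  have x : Primrec fun z : (α × List (RatCode × StarWord)) × (RatCode × StarWord) × RatCode =>
    z.1.1 := Primrec.fst.comp Primrec.fst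
  have c : Primrec fun z : (α × List (RatCode × StarWord)) × (RatCode × StarWord) × RatCode =>
    z.2.1.1 := Primrec.fst.comp (Primrec.fst.comp Primrec.snd)
  have w : Primrec fun z : (α × List (RatCode × StarWord)) × (RatCode × StarWord) × RatCode =>
    z.2.1.2 := Primrec.snd.comp (Primrec.fst.comp Primrec.snd)
  have d := Primrec.snd.comp (Primrec.snd.comp c)
  exact RatCode.primrec_add.comp
    (RatCode.primrec_mul.comp ((Primrec.fst.comp c).pair ((Primrec.const 0).pair d))
      ((primrec_wordCode hv').comp x w))
    (RatCode.primrec_add.comp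
      (RatCode.primrec_mul.comp
        ((Primrec.const 0).pair ((Primrec.fst.comp (Primrec.snd.comp c)).pair d))
        ((primrec_wordCode hv).comp x w))
      (Primrec.snd.comp Primrec.snd))

theorem primrec_pieceValue {T : α → ℕ → Bool} (hT : Primrec₂ T) {k : α → ℕ} (hk : Primrec k)
    {σ : Type*} [Primcodable σ] (zero one : σ) {t : α → σ} (ht : Primrec t) :
    Primrec₂ fun a j => pieceValue (T a) (k a) j zero one (t a) := by
  have hk' : Primrec fun x : α × ℕ => k x.1 := hk.comp Primrec.fst
  have ht' : Primrec fun x : α × ℕ => t x.1 := ht.comp Primrec.fst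
  have hk0 : PrimrecPred fun x : α × ℕ => k x.1 = 0 := Primrec.eq.comp hk' (Primrec.const 0)
  refine Primrec.ite (Primrec.eq.comp Primrec.snd (Primrec.const 0))
    (Primrec.ite hk0 (Primrec.const _) (Primrec.const _)) ?_
  refine Primrec.ite (Primrec.eq.comp hk' Primrec.snd) ht' ?_
  refine Primrec.ite hk0 (Primrec.cond ?_ ht' (Primrec.const _)) (Primrec.const _)
  exact hT.comp Primrec.fst (Primrec.pred.comp Primrec.snd)

theorem primrec_normSqCode {T : α → ℕ → Bool} (hT : Primrec₂ T) {k : α → ℕ} (hk : Primrec k)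
    {s : α → (RatCode × RatCode) × RatCode × RatCode} (hs : Primrec s)
    {p : α → RatStarPoly} (hp : Primrec p) :
    Primrec fun a => normSqCode (T a) (k a) (s a) (p a) := by
  have hre : Primrec fun a => (p a).rePart :=
    Primrec.list_map hp ((Primrec.fst.comp (Primrec.fst.comp Primrec.snd)).pair
      (Primrec.snd.comp Primrec.snd))
  have him : Primrec fun a => (p a).imPart :=
    Primrec.list_map hp ((Primrec.snd.comp (Primrec.fst.comp Primrec.snd)).pair
      (Primrec.snd.comp Primrec.snd))
  have hv {t : α → RatCode} (ht : Primrec t) :=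
    primrec_pieceValue hT hk ((0, 0, 0) : RatCode) (1, 0, 0) ht
  have hx := (primrec_polyBoundCode (hv (Primrec.fst.comp (Primrec.fst.comp hs)))
    (hv (Primrec.snd.comp (Primrec.fst.comp hs)))).comp Primrec.id hre
  have hy := (primrec_polyBoundCode (hv (Primrec.fst.comp (Primrec.snd.comp hs)))
    (hv (Primrec.snd.comp (Primrec.snd.comp hs)))).comp Primrec.id him
  exact RatCode.primrec_add.comp (RatCode.primrec_mul.comp hx hx) (RatCode.primrec_mul.comp hy hy)

theorem primrec_meshPoint : Primrec₂ meshPoint :=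
  (Primrec.nat_add.comp
      (Primrec.nat_mul.comp (Primrec.const 3) (Primrec.succ.comp Primrec.fst))
      (Primrec.nat_mul.comp (Primrec.const 2) Primrec.snd)).pair
    ((Primrec.const 0).pair (Primrec.nat_add.comp
      (Primrec.nat_mul.comp (Primrec.const 4) Primrec.fst) (Primrec.const 3)))

theorem primrecPred_lowerTest {T : α → ℕ → Bool} (hT : Primrec₂ T) {r : α → RatCode}
    (hr : Primrec r) {n k N a : α → ℕ} (hn : Primrec n) (hk : Primrec k) (hN : Primrec N)
    (ha : Primrec a) : PrimrecPred fun x => LowerTest (T x) (r x) (n x) (k x) (N x) (a x) := by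
  have hm := primrec_meshPoint.comp hN ha
  exact RatCode.primrecRel_lt.comp (RatCode.primrec_mul.comp hr hr)
    (primrec_normSqCode hT hk ((hm.pair hm).pair (hm.pair hm)) ((Primrec.ofNat _).comp hn))

theorem primrecPred_upperTest {T : α → ℕ → Bool} (hT : Primrec₂ T) {r : α → RatCode}
    (hr : Primrec r) {n k N a : α → ℕ} (hn : Primrec n) (hk : Primrec k) (hN : Primrec N)
    (ha : Primrec a) : PrimrecPred fun x => UpperTest (T x) (r x) (n x) (k x) (N x) (a x) := by
  have hm := primrec_meshPoint.comp hN ha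
  have hm' := primrec_meshPoint.comp hN (Primrec.succ.comp ha)
  have h {s s' : α → RatCode × RatCode} (hs : Primrec s) (hs' : Primrec s') :=
    RatCode.primrecRel_lt.comp
      (primrec_normSqCode hT hk (hs.pair hs') ((Primrec.ofNat _).comp hn))
      (RatCode.primrec_mul.comp hr hr)
  refine PrimrecPred.of_eq
    (((h (hm.pair hm') (hm.pair hm')).and (h (hm.pair hm') (hm'.pair hm))).and
      ((h (hm'.pair hm) (hm.pair hm')).and (h (hm'.pair hm) (hm'.pair hm)))) fun x => ?_
  simp [UpperTest, ratStarPoly]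

theorem primrecPred_diagramTest {T : α → ℕ → Bool} (hT : Primrec₂ T) :
    PrimrecPred fun x : α × (RatCode × ℕ × RatCode) × ℕ => DiagramTest (T x.1) x.2.1 x.2.2 := by
  let β := α × (RatCode × ℕ × RatCode) × ℕ
  have hr : Primrec fun x : β => x.2.1.1 := Primrec.fst.comp (Primrec.fst.comp Primrec.snd)
  have hn : Primrec fun x : β => x.2.1.2.1 :=
    Primrec.fst.comp (Primrec.snd.comp (Primrec.fst.comp Primrec.snd))
  have hr' : Primrec fun x : β => x.2.1.2.2 :=
    Primrec.snd.comp (Primrec.snd.comp (Primrec.fst.comp Primrec.snd))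
  have hN : Primrec fun x : β => x.2.2 := Primrec.snd.comp Primrec.snd
  have hK : Primrec fun x : β => x.2.1.2.1 + 2 := Primrec.succ.comp (Primrec.succ.comp hn)
  have hx : Primrec fun y : ℕ × ℕ × β => y.2.2 := Primrec.snd.comp Primrec.snd
  have hk : Primrec fun y : ℕ × ℕ × β => y.2.1 := Primrec.fst.comp Primrec.snd
  have hT' : Primrec₂ fun (y : ℕ × ℕ × β) => T y.2.2.1 :=
    hT.comp (Primrec.fst.comp (hx.comp Primrec.fst)) Primrec.snd
  refine (PrimrecPred.and ?_ ?_).and (PrimrecPred.and ?_ ?_)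
  · exact RatCode.primrecRel_lt.comp (Primrec.const _) hr
  · exact RatCode.primrecRel_lt.comp (Primrec.const _) hr'
  · have h1 : PrimrecRel fun (a : ℕ) (y : ℕ × β) =>
        LowerTest (T y.2.1) y.2.2.1.1 y.2.2.1.2.1 y.1 y.2.2.2 a :=
      primrecPred_lowerTest hT' (hr.comp hx) (hn.comp hx) hk (hN.comp hx) Primrec.fst
    have h2 : PrimrecRel fun (k : ℕ) (x : β) =>
        ∃ a < x.2.2 + 2, LowerTest (T x.1) x.2.1.1 x.2.1.2.1 k x.2.2 a :=
      h1.exists_lt_of (Primrec.succ.comp (Primrec.succ.comp (hN.comp Primrec.snd)))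
    exact h2.exists_lt_of hK
  · have h1 : PrimrecRel fun (a : ℕ) (y : ℕ × β) =>
        UpperTest (T y.2.1) y.2.2.1.2.2 y.2.2.1.2.1 y.1 y.2.2.2 a :=
      primrecPred_upperTest hT' (hr'.comp hx) (hn.comp hx) hk (hN.comp hx) Primrec.fst
    have h2 : PrimrecRel fun (k : ℕ) (x : β) =>
        ∀ a < x.2.2 + 1, UpperTest (T x.1) x.2.1.2.2 x.2.1.2.1 k x.2.2 a :=
      h1.forall_lt_of (Primrec.succ.comp (hN.comp Primrec.snd))
    exact h2.forall_lt_of hK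

end Primrec

/-! ### Correctness of the test -/

open Filter Topology

theorem toRat_meshPoint (N a : ℕ) :
    ((meshPoint N a).toRat : ℝ) = 3 / 4 + a / (2 * (N + 1)) := by
  have h : (4 * (N : ℝ) + 3 + 1) ≠ 0 := by positivity
  simp only [RatCode.toRat, meshPoint]
  push_cast
  field_simp
  ring

theorem toRat_meshPoint_mem {N a : ℕ} (ha : a < N + 2) :
    ((meshPoint N a).toRat : ℝ) ∈ Set.Icc (3 / 4 : ℝ) (5 / 4) := by
  have h : (a : ℝ) / (2 * (N + 1)) ≤ 1 / 2 := by
    have : (a : ℝ) ≤ N + 1 := by exact_mod_cast Nat.lt_succ_iff.1 ha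
    rw [div_le_iff₀ (by positivity)]
    linarith
  have h0 : 0 ≤ (a : ℝ) / (2 * (N + 1)) := by positivity
  rw [toRat_meshPoint]
  constructor <;> linarith

theorem toRat_meshPoint_succ (N a : ℕ) :
    ((meshPoint N (a + 1)).toRat : ℝ) = (meshPoint N a).toRat + 1 / (2 * (N + 1)) := by
  rw [toRat_meshPoint, toRat_meshPoint]
  push_cast
  ring

theorem exists_meshPoint_le {t : ℝ} (ht : t ∈ Set.Icc (3 / 4 : ℝ) (5 / 4)) (N : ℕ) :
    ∃ a < N + 1, ((meshPoint N a).toRat : ℝ) ≤ t ∧ t ≤ (meshPoint N (a + 1)).toRat := by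
  obtain ⟨h1, h2⟩ := ht
  have hN : (0 : ℝ) < 2 * (N + 1) := by positivity
  have h0 : 0 ≤ (t - 3 / 4) * (2 * (N + 1)) := mul_nonneg (by linarith) hN.le
  simp only [toRat_meshPoint]
  rcases h2.lt_or_eq with h2 | rfl
  · refine ⟨⌊(t - 3 / 4) * (2 * (N + 1))⌋₊, ?_, ?_, ?_⟩
    · rw [Nat.floor_lt h0]
      push_cast
      nlinarith
    · have := Nat.floor_le h0
      rw [← div_le_iff₀ hN] at this
      linarith
    · have := (Nat.lt_floor_add_one ((t - 3 / 4) * (2 * ((N : ℝ) + 1)))).le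
      rw [← le_div_iff₀ hN] at this
      push_cast
      linarith
  -- At the right endpoint the floor would be `N + 1`, one more than the last cell.
  · refine ⟨N, by omega, ?_, ?_⟩
    · have : (N : ℝ) / (2 * (N + 1)) ≤ 1 / 2 := by
        rw [div_le_iff₀ hN]
        linarith
      linarith
    · have : ((N + 1 : ℕ) : ℝ) / (2 * (N + 1)) = 1 / 2 := by
        push_cast
        field_simp
      linarith

theorem eventually_mesh_lt {δ : ℝ} (hδ : 0 < δ) : ∀ᶠ N : ℕ in atTop, 1 / (2 * ((N : ℝ) + 1)) < δ := by
  have h := (tendsto_one_div_add_atTop_nhds_zero_nat (𝕜 := ℝ)).eventually (gt_mem_nhds hδ)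
  filter_upwards [h] with N hN
  refine lt_of_le_of_lt ?_ hN
  gcongr
  have : (0 : ℝ) ≤ N := by positivity
  linarith

theorem eventually_exists_mesh_lt {φ : ℝ → ℝ} (hφ : Continuous φ) {r t : ℝ}
    (ht : t ∈ Set.Icc (3 / 4 : ℝ) (5 / 4)) (h : r < φ t) :
    ∀ᶠ N in atTop, ∃ a < N + 2, r < φ (meshPoint N a).toRat := by
  obtain ⟨δ, hδ, hball⟩ := Metric.mem_nhds_iff.1 (hφ.continuousAt.eventually (lt_mem_nhds h))
  filter_upwards [eventually_mesh_lt hδ] with N hN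
  obtain ⟨a, ha, h1, h2⟩ := exists_meshPoint_le ht N
  rw [toRat_meshPoint_succ] at h2
  refine ⟨a, by omega, hball ?_⟩
  rw [Metric.mem_ball, Real.dist_eq, abs_lt]
  constructor <;> linarith

/-- The diagonal over the interval is compact, so the strict inequality persists on a uniform
neighbourhood of it, which contains all pairs of adjacent points of a fine mesh. -/
theorem eventually_forall_mesh_lt {φ : ℝ × ℝ → ℝ} (hφ : Continuous φ) {r : ℝ}
    (h : ∀ t ∈ Set.Icc (3 / 4 : ℝ) (5 / 4), φ (t, t) < r) :
    ∀ᶠ N in atTop, ∀ a < N + 1,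
      φ ((meshPoint N a).toRat, (meshPoint N (a + 1)).toRat) < r := by
  have hK : IsCompact ((fun t : ℝ => (t, t)) '' Set.Icc (3 / 4 : ℝ) (5 / 4)) :=
    isCompact_Icc.image (by fun_prop)
  obtain ⟨δ, hδ, hsub⟩ := hK.exists_thickening_subset_open (isOpen_lt hφ continuous_const)
    (Set.image_subset_iff.2 h)
  filter_upwards [eventually_mesh_lt hδ] with N hN a ha
  refine hsub (Metric.mem_thickening_iff.2
    ⟨_, Set.mem_image_of_mem _ (toRat_meshPoint_mem (N := N) (a := a) (by omega)), ?_⟩)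
  rw [Prod.dist_eq, dist_self, toRat_meshPoint_succ, Real.dist_eq, add_sub_cancel_left,
    abs_of_pos (by positivity)]
  exact max_lt hδ hN

/-! ### Values of polynomials on a piece and their interval bounds -/

noncomputable def pieceEval (T : ℕ → Bool) (k : ℕ) (t : ℝ) (p : RatStarPoly) : ℂ :=
  RatStarPoly.eval (fun j => ((pieceValue T k j 0 1 t : ℝ) : ℂ)) p

noncomputable def normSqBound (T : ℕ → Bool) (k : ℕ) (s : (ℝ × ℝ) × ℝ × ℝ) (p : RatStarPoly) : ℝ :=
  polyBound (fun j => pieceValue T k j 0 1 s.1.1) (fun j => pieceValue T k j 0 1 s.1.2)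
      p.rePart ^ 2 +
    polyBound (fun j => pieceValue T k j 0 1 s.2.1) (fun j => pieceValue T k j 0 1 s.2.2)
      p.imPart ^ 2

theorem toRat_normSqCode (T : ℕ → Bool) (k : ℕ) (s : (RatCode × RatCode) × RatCode × RatCode)
    (p : RatStarPoly) :
    ((normSqCode T k s p).toRat : ℝ) =
      normSqBound T k ((s.1.1.toRat, s.1.2.toRat), s.2.1.toRat, s.2.2.toRat) p := by
  simp only [normSqCode, normSqBound]
  rw [RatCode.toRat_add, RatCode.toRat_mul, RatCode.toRat_mul]
  push_cast
  rw [toRat_polyBoundCode, toRat_polyBoundCode]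
  simp only [map_pieceValue (fun q : RatCode => ((q.toRat : ℚ) : ℝ))]
  simp [RatCode.toRat, sq]

theorem norm_sq_pieceEval (T : ℕ → Bool) (k : ℕ) (t : ℝ) (p : RatStarPoly) :
    ‖pieceEval T k t p‖ ^ 2 = normSqBound T k ((t, t), t, t) p := by
  rw [pieceEval, RatStarPoly.eval_ofReal, Complex.sq_norm, Complex.normSq_mk, normSqBound]
  ring

theorem continuous_pieceValue (T : ℕ → Bool) (k j : ℕ) :
    Continuous fun t : ℝ => pieceValue T k j 0 1 t := by
  unfold pieceValue
  split_ifs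
  · exact continuous_const
  · exact continuous_const
  · exact continuous_id
  · cases T (j - 1)
    · exact continuous_const
    · exact continuous_id
  · exact continuous_const

theorem pieceValue_mono (T : ℕ → Bool) (k j : ℕ) :
    Monotone fun t : ℝ => pieceValue T k j 0 1 t := by
  intro s t hst
  simp only [pieceValue]
  split_ifs
  all_goals first | exact le_rfl | exact hst | (cases T (j - 1) <;> simp [hst])

theorem pieceValue_nonneg (T : ℕ → Bool) (k j : ℕ) {t : ℝ} (ht : 0 ≤ t) :
    0 ≤ pieceValue T k j 0 1 t := by
  unfold pieceValue
  split_ifs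
  all_goals first | exact le_rfl | exact zero_le_one | exact ht | (cases T (j - 1) <;> simp [ht])

/-- Each generator is eventually constant along the pieces. Its eventual value is also the one it
takes at the limit point `0`. -/
theorem pieceValue_eq_of_lt (T : ℕ → Bool) {k k' j : ℕ} (h : j < k) (h' : j < k') (t t' : ℝ) :
    pieceValue T k j 0 1 t = pieceValue T k' j 0 1 t' := by
  unfold pieceValue
  rw [if_neg (show k ≠ 0 by omega), if_neg (show k' ≠ 0 by omega), if_neg (show k ≠ j by omega),
    if_neg (show k' ≠ j by omega), if_neg (show k ≠ 0 by omega), if_neg (show k' ≠ 0 by omega)]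

theorem continuous_normSqBound (T : ℕ → Bool) (k : ℕ) (p : RatStarPoly) :
    Continuous fun s => normSqBound T k s p := by
  have h j := continuous_pieceValue T k j
  refine ((continuous_polyBound (fun j => ?_) (fun j => ?_) _).pow 2).add
    ((continuous_polyBound (fun j => ?_) (fun j => ?_) _).pow 2)
  · exact (h j).comp (continuous_fst.comp continuous_fst)
  · exact (h j).comp (continuous_snd.comp continuous_fst)
  · exact (h j).comp (continuous_fst.comp continuous_snd)
  · exact (h j).comp (continuous_snd.comp continuous_snd)

theorem RatStarPoly.eval_congr {A : Type*} [NonUnitalCStarAlgebra A] {n : ℕ} {u v : ℕ → A}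
    (h : ∀ j ≤ n, u j = v j) {p : RatStarPoly}
    (hp : ∀ m ∈ p, m.2.1.index ≤ n ∧ ∀ l ∈ m.2.2, l.index ≤ n) :
    RatStarPoly.eval u p = RatStarPoly.eval v p := by
  have hl : ∀ l : StarLetter, l.index ≤ n → l.eval u = l.eval v := by
    rintro (j | j) hj
    · exact h j hj
    · exact congrArg star (h j hj)
  unfold RatStarPoly.eval
  congr 1
  refine List.map_congr_left fun m hm => ?_
  rw [RatStarMonomial.eval, RatStarMonomial.eval, hl _ (hp m hm).1]
  congr 1
  exact List.foldl_ext _ _ _ fun x l hl' => by rw [hl _ ((hp m hm).2 l hl')]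

theorem pieceEval_eq_of_lt (T : ℕ → Bool) {n k k' : ℕ} (h : n < k) (h' : n < k') (t : ℝ) :
    pieceEval T k t (ratStarPoly n) = pieceEval T k' t (ratStarPoly n) :=
  RatStarPoly.eval_congr (n := n)
    (fun j hj => by rw [pieceValue_eq_of_lt T (hj.trans_lt h) (hj.trans_lt h') t t])
    fun _ hm => index_le_of_mem_ratStarPoly hm

/-- Every piece has the same polynomial values as a piece of small number. -/
theorem exists_pieceEval_eq (n k : ℕ) :
    ∃ k' < n + 2, ∀ (T : ℕ → Bool) (t : ℝ),
      pieceEval T k t (ratStarPoly n) = pieceEval T k' t (ratStarPoly n) := by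
  by_cases h : k < n + 2
  · exact ⟨k, h, fun _ _ => rfl⟩
  · exact ⟨n + 1, by omega, fun T t => pieceEval_eq_of_lt T (by omega) (by omega) t⟩

theorem sq_le_max_sq {x y z : ℝ} (h : x ≤ y) (h' : y ≤ z) : y ^ 2 ≤ max (x ^ 2) (z ^ 2) := by
  rcases le_total 0 y with hy | hy
  · exact le_max_of_le_right (by nlinarith)
  · exact le_max_of_le_left (by nlinarith)

theorem norm_sq_pieceEval_lt (T : ℕ → Bool) (k : ℕ) {s t s' r : ℝ} (hs : 0 ≤ s) (h : s ≤ t)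
    (h' : t ≤ s') (p : RatStarPoly)
    (hr : ∀ x ∈ [(s, s'), (s', s)], ∀ y ∈ [(s, s'), (s', s)], normSqBound T k (x, y) p < r) :
    ‖pieceEval T k t p‖ ^ 2 < r := by
  have hmono : ∀ q, polyBound (fun j => pieceValue T k j 0 1 s') (fun j => pieceValue T k j 0 1 s) q
      ≤ polyBound (fun j => pieceValue T k j 0 1 t) (fun j => pieceValue T k j 0 1 t) q :=
    polyBound_mono (fun j => pieceValue_nonneg T k j (hs.trans h))
      (fun j => pieceValue_nonneg T k j hs) (fun j => pieceValue_mono T k j h')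
      (fun j => pieceValue_mono T k j h)
  have hmono' : ∀ q, polyBound (fun j => pieceValue T k j 0 1 t) (fun j => pieceValue T k j 0 1 t) q
      ≤ polyBound (fun j => pieceValue T k j 0 1 s) (fun j => pieceValue T k j 0 1 s') q :=
    polyBound_mono (fun j => pieceValue_nonneg T k j hs)
      (fun j => pieceValue_nonneg T k j (hs.trans h)) (fun j => pieceValue_mono T k j h)
      (fun j => pieceValue_mono T k j h')
  have hre := sq_le_max_sq (hmono p.rePart) (hmono' p.rePart)
  have him := sq_le_max_sq (hmono p.imPart) (hmono' p.imPart)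
  simp only [List.mem_cons, List.not_mem_nil, or_false, forall_eq_or_imp, forall_eq,
    normSqBound] at hr
  rw [norm_sq_pieceEval, normSqBound]
  rcases le_max_iff.1 hre with hre | hre <;> rcases le_max_iff.1 him with him | him
  · linarith [hr.2.2]
  · linarith [hr.2.1]
  · linarith [hr.1.2]
  · linarith [hr.1.1]

theorem lowerTest_iff {T : ℕ → Bool} {r : RatCode} (hr : 0 < r.toRat) {n k N a : ℕ} :
    LowerTest T r n k N a ↔
      (r.toRat : ℝ) < ‖pieceEval T k (meshPoint N a).toRat (ratStarPoly n)‖ := by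
  rw [LowerTest, RatCode.lt_iff, ← Rat.cast_lt (K := ℝ), toRat_normSqCode, ← norm_sq_pieceEval,
    RatCode.toRat_mul, ← sq]
  push_cast
  rw [sq_lt_sq₀ (by exact_mod_cast hr.le) (norm_nonneg _)]

theorem upperTest_iff {T : ℕ → Bool} {r : RatCode} {n k N a : ℕ} :
    UpperTest T r n k N a ↔
      ∀ x ∈ [(((meshPoint N a).toRat : ℝ), ((meshPoint N (a + 1)).toRat : ℝ)),
          (((meshPoint N (a + 1)).toRat : ℝ), ((meshPoint N a).toRat : ℝ))],
        ∀ y ∈ [(((meshPoint N a).toRat : ℝ), ((meshPoint N (a + 1)).toRat : ℝ)),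
          (((meshPoint N (a + 1)).toRat : ℝ), ((meshPoint N a).toRat : ℝ))],
        normSqBound T k (x, y) (ratStarPoly n) < (r.toRat : ℝ) ^ 2 := by
  simp only [UpperTest, RatCode.lt_iff, ← Rat.cast_lt (K := ℝ), toRat_normSqCode,
    RatCode.toRat_mul, Rat.cast_pow, ← sq, List.mem_cons, List.not_mem_nil, or_false,
    forall_eq_or_imp, forall_eq]

theorem eventually_upperTest {T : ℕ → Bool} {r : RatCode} {n k : ℕ}
    (h : ∀ t ∈ Set.Icc (3 / 4 : ℝ) (5 / 4), ‖pieceEval T k t (ratStarPoly n)‖ < r.toRat) :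
    ∀ᶠ N in atTop, ∀ a < N + 1, UpperTest T r n k N a := by
  have hdiag : ∀ t ∈ Set.Icc (3 / 4 : ℝ) (5 / 4),
      normSqBound T k ((t, t), t, t) (ratStarPoly n) < (r.toRat : ℝ) ^ 2 := by
    intro t ht
    rw [← norm_sq_pieceEval]
    exact pow_lt_pow_left₀ (h t ht) (norm_nonneg _) two_ne_zero
  have hc := continuous_normSqBound T k (ratStarPoly n)
  have h1 := eventually_forall_mesh_lt
    (φ := fun s => normSqBound T k ((s.1, s.2), s.1, s.2) (ratStarPoly n)) (by fun_prop) hdiag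
  have h2 := eventually_forall_mesh_lt
    (φ := fun s => normSqBound T k ((s.1, s.2), s.2, s.1) (ratStarPoly n)) (by fun_prop) hdiag
  have h3 := eventually_forall_mesh_lt
    (φ := fun s => normSqBound T k ((s.2, s.1), s.1, s.2) (ratStarPoly n)) (by fun_prop) hdiag
  have h4 := eventually_forall_mesh_lt
    (φ := fun s => normSqBound T k ((s.2, s.1), s.2, s.1) (ratStarPoly n)) (by fun_prop) hdiag
  filter_upwards [h1, h2, h3, h4] with N h1 h2 h3 h4 a ha
  rw [upperTest_iff]
  simp only [List.mem_cons, List.not_mem_nil, or_false, forall_eq_or_imp, forall_eq]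
  exact ⟨⟨h1 a ha, h2 a ha⟩, h3 a ha, h4 a ha⟩

/-- Soundness holds at each precision: mesh points lie on the pieces and the interval bounds cover
every cell. Completeness follows by continuity and compactness, as both inequalities are strict. -/
theorem exists_diagramTest_iff (T : ℕ → Bool) (c : RatCode × ℕ × RatCode) :
    (∃ N, DiagramTest T c N) ↔ 0 < c.1.toRat ∧ 0 < c.2.2.toRat ∧
      (∃ k, ∃ t ∈ Set.Icc (3 / 4 : ℝ) (5 / 4),
        (c.1.toRat : ℝ) < ‖pieceEval T k t (ratStarPoly c.2.1)‖) ∧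
      ∀ k, ∀ t ∈ Set.Icc (3 / 4 : ℝ) (5 / 4),
        ‖pieceEval T k t (ratStarPoly c.2.1)‖ < c.2.2.toRat := by
  obtain ⟨r, n, r'⟩ := c
  have h0 : RatCode.toRat (0, 0, 0) = 0 := by simp [RatCode.toRat]
  simp only [DiagramTest, RatCode.lt_iff, h0]
  constructor
  · rintro ⟨N, ⟨hr, hr'⟩, ⟨k, -, a, ha, hlow⟩, hup⟩
    refine ⟨hr, hr', ⟨k, _, toRat_meshPoint_mem ha, (lowerTest_iff hr).1 hlow⟩, fun k t ht => ?_⟩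
    obtain ⟨k', hk', heq⟩ := exists_pieceEval_eq n k
    obtain ⟨a, ha, h1, h2⟩ := exists_meshPoint_le ht N
    rw [heq]
    refine lt_of_pow_lt_pow_left₀ 2 (by exact_mod_cast hr'.le) ?_
    exact norm_sq_pieceEval_lt T k'
      (le_trans (by norm_num) (toRat_meshPoint_mem (N := N) (a := a) (by omega)).1) h1 h2 _
      (upperTest_iff.1 (hup k' hk' a ha))
  · rintro ⟨hr, hr', ⟨k, t, ht, hlow⟩, hup⟩
    obtain ⟨k', hk', heq⟩ := exists_pieceEval_eq n k
    rw [heq] at hlow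
    have hc : Continuous fun t => ‖pieceEval T k' t (ratStarPoly n)‖ := by
      have h : (fun t => ‖pieceEval T k' t (ratStarPoly n)‖) =
          fun t => √(normSqBound T k' ((t, t), t, t) (ratStarPoly n)) := by
        funext t
        rw [← norm_sq_pieceEval, Real.sqrt_sq (norm_nonneg _)]
      rw [h]
      exact ((continuous_normSqBound T k' _).comp (by fun_prop)).sqrt
    have hL := eventually_exists_mesh_lt hc ht hlow
    -- Only finitely many pieces are involved, so one precision serves them all.
    have hU : ∀ᶠ N in atTop, ∀ k ∈ Set.Iio (n + 2), ∀ a < N + 1, UpperTest T r' n k N a :=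
      (eventually_all_finite (Set.finite_Iio _)).2 fun k _ => eventually_upperTest (hup k)
    obtain ⟨N, ⟨a, ha, hN⟩, hN'⟩ := (hL.and hU).exists
    exact ⟨N, ⟨hr, hr'⟩, ⟨k', hk', a, ha, (lowerTest_iff hr).2 hN⟩, hN'⟩

/-! ### A uniform enumeration of the diagram -/

theorem RatCode.toRat_surjective : Function.Surjective RatCode.toRat := by
  intro q
  refine ⟨(q.num.toNat, (-q.num).toNat, q.den - 1), ?_⟩
  have h1 : ((q.num.toNat : ℤ) : ℚ) - ((-q.num).toNat : ℤ) = q.num := by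
    rw [← Int.cast_sub, Int.toNat_sub_toNat_neg]
  have h2 : ((q.den - 1 : ℕ) : ℚ) + 1 = q.den := by
    exact_mod_cast congrArg (Nat.cast (R := ℚ)) (Nat.sub_add_cancel q.den_pos)
  simp only [RatCode.toRat]
  rw [h2]
  push_cast at h1
  rw [h1, Rat.num_div_den]

/-- The code of the triple `(1/2, j, 3/2)`, where the polynomial of number `j` is `x_0`. -/
def unitTriple : RatCode × ℕ × RatCode :=
  ((1, 0, 1), Encodable.encode ([(((1, 0, 0), (0, 0, 0)), Sum.inl 0, [])] : RatStarPoly), (3, 0, 1))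

open Classical in
/-- The enumeration, along `g`, of the triples that pass the test for some precision, and of a
default one. -/
noncomputable def testEnum (g : ℕ → RatCode × ℕ × RatCode) (T : ℕ → Bool) (default : ℕ)
    (m : ℕ × ℕ) : ℕ :=
  if DiagramTest T (g m.1) m.2 then m.1 else default

theorem primrec_testEnum {α : Type*} [Primcodable α] {g : ℕ → RatCode × ℕ × RatCode}
    (hg : Primrec g) {T : α → ℕ → Bool} (hT : Primrec₂ T) (c : ℕ) :
    Primrec₂ fun a m => testEnum g (T a) c m := by
  classical
  have h : PrimrecPred fun x : α × ℕ × ℕ => DiagramTest (T x.1) (g x.2.1) x.2.2 :=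
    (primrecPred_diagramTest hT).comp (Primrec.fst.pair
      ((hg.comp (Primrec.fst.comp Primrec.snd)).pair (Primrec.snd.comp Primrec.snd)))
  exact Primrec.ite h (Primrec.fst.comp Primrec.snd) (Primrec.const c)

/-- The enumeration of the diagram. -/
noncomputable def diagramEnum (T : ℕ → Bool) (m : ℕ) : ℕ :=
  testEnum (Denumerable.ofNat _) T (Encodable.encode unitTriple) m.unpair

theorem primrec_diagramEnum {α : Type*} [Primcodable α] {T : α → ℕ → Bool} (hT : Primrec₂ T) :
    Primrec₂ fun a m => diagramEnum (T a) m :=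
  (primrec_testEnum (Primrec.ofNat _) hT _).comp Primrec.fst (Primrec.unpair.comp Primrec.snd)

/-- Generator `0` is `0` on piece `0` and `1` on the others, whatever `T` is. The default output of
the enumeration is therefore always legitimate. -/
theorem exists_diagramTest_unitTriple (T : ℕ → Bool) : ∃ N, DiagramTest T unitTriple N := by
  have hv : ∀ k t, pieceEval T k t (ratStarPoly unitTriple.2.1) = if k = 0 then 0 else 1 := by
    intro k t
    have h : ratStarPoly unitTriple.2.1 = [(((1, 0, 0), (0, 0, 0)), Sum.inl 0, [])] :=
      Denumerable.ofNat_encode _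
    have h1 : (⟨1, 0⟩ : ℂ) = 1 := rfl
    rw [h]
    split_ifs with hk <;>
    simp [pieceEval, RatStarPoly.eval, RatStarMonomial.eval, StarLetter.eval, RatCode.toRat, hk,
      pieceValue, h1]
  rw [exists_diagramTest_iff]
  refine ⟨by norm_num [unitTriple, RatCode.toRat], by norm_num [unitTriple, RatCode.toRat],
    ⟨1, 1, by norm_num, ?_⟩, fun k t _ => ?_⟩
  · rw [hv]
    norm_num [unitTriple, RatCode.toRat]
  · rw [hv]
    split_ifs <;> norm_num [unitTriple, RatCode.toRat]

theorem exists_decodeTriple_diagramEnum_iff (T : ℕ → Bool) (t : ℚ × ℕ × ℚ) :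
    (∃ m, CStarPresentation.decodeTriple (diagramEnum T m) = t) ↔
      ∃ c : RatCode × ℕ × RatCode, (c.1.toRat, c.2.1, c.2.2.toRat) = t ∧ ∃ N, DiagramTest T c N := by
  have hdec : ∀ c : RatCode × ℕ × RatCode,
      CStarPresentation.decodeTriple (Encodable.encode c) = (c.1.toRat, c.2.1, c.2.2.toRat) := by
    intro c
    rw [CStarPresentation.decodeTriple, Denumerable.ofNat_encode]
  constructor
  · rintro ⟨m, rfl⟩
    by_cases h : DiagramTest T (Denumerable.ofNat (RatCode × ℕ × RatCode) m.unpair.1) m.unpair.2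
    · exact ⟨_, by rw [diagramEnum, testEnum, if_pos h, CStarPresentation.decodeTriple], _, h⟩
    · exact ⟨_, by rw [diagramEnum, testEnum, if_neg h, hdec], exists_diagramTest_unitTriple T⟩
  · rintro ⟨c, rfl, N, h⟩
    refine ⟨Nat.pair (Encodable.encode c) N, ?_⟩
    rw [diagramEnum, testEnum, Nat.unpair_pair, Denumerable.ofNat_encode, if_pos h, hdec]

theorem ContinuousMap.ratStarPoly_eval_apply {X : Type*} [TopologicalSpace X] [CompactSpace X]
    (u : ℕ → C(X, ℂ)) (p : RatStarPoly) (x : X) :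
    RatStarPoly.eval u p x = RatStarPoly.eval (fun j => u j x) p := by
  have hl : ∀ l : StarLetter, l.eval u x = l.eval (fun j => u j x) := by
    rintro (j | j) <;> rfl
  have hw : ∀ (w : List StarLetter) (a : C(X, ℂ)),
      w.foldl (fun a l => a * l.eval u) a x =
        w.foldl (fun a l => a * l.eval (fun j => u j x)) (a x) := by
    intro w
    induction w with
    | nil => intro a; rfl
    | cons b w ih =>
      intro a
      rw [List.foldl_cons, List.foldl_cons, ih, ContinuousMap.mul_apply, hl]
  induction p with
  | nil => rfl
  | cons m p ih =>
    simp only [RatStarPoly.eval, List.map_cons, List.sum_cons, ContinuousMap.add_apply] at ih ⊢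
    rw [ih, RatStarMonomial.eval, ContinuousMap.smul_apply, hw, hl]
    rfl

theorem RatStarPoly.eval_zero {A : Type*} [NonUnitalCStarAlgebra A] (p : RatStarPoly) :
    RatStarPoly.eval (fun _ => (0 : A)) p = 0 := by
  have hl : ∀ l : StarLetter, l.eval (fun _ => (0 : A)) = 0 := by
    rintro (j | j)
    · rfl
    · exact star_zero A
  have hw : ∀ w : List StarLetter,
      w.foldl (fun a l => a * l.eval (fun _ => (0 : A))) 0 = 0 := by
    intro w
    induction w with
    | nil => rfl
    | cons b w ih => rw [List.foldl_cons, zero_mul, ih]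
  refine List.sum_eq_zero fun y hy => ?_
  obtain ⟨m, -, rfl⟩ := List.mem_map.1 hy
  rw [RatStarMonomial.eval, hl, hw, smul_zero]

/-- A presentation of an algebra of continuous functions whose generators have the values that are
given by `pieceValue` is named by `diagramEnum`. -/
theorem isName_diagramEnum {X : Type*} [TopologicalSpace X] [CompactSpace X]
    (P : CStarPresentation C(X, ℂ)) (T : ℕ → Bool)
    (h : ∀ (n : ℕ) (x : X), ∃ k, ∃ t ∈ Set.Icc (3 / 4 : ℝ) (5 / 4),
      ∀ j ≤ n, P.vec j x = ((pieceValue T k j 0 1 t : ℝ) : ℂ))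
    (h' : ∀ k, ∀ t ∈ Set.Icc (3 / 4 : ℝ) (5 / 4),
      (∃ x, ∀ j, P.vec j x = ((pieceValue T k j 0 1 t : ℝ) : ℂ)) ∨
        ∀ j, pieceValue T k j 0 1 t = 0) :
    P.IsName (diagramEnum T) := by
  have hx : ∀ n x, ∃ k, ∃ t ∈ Set.Icc (3 / 4 : ℝ) (5 / 4),
      P.ratVec n x = pieceEval T k t (ratStarPoly n) := by
    intro n x
    obtain ⟨k, t, ht, hk⟩ := h n x
    refine ⟨k, t, ht, ?_⟩
    rw [CStarPresentation.ratVec, ContinuousMap.ratStarPoly_eval_apply]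
    exact RatStarPoly.eval_congr hk fun m hm => index_le_of_mem_ratStarPoly hm
  have hk : ∀ n k, ∀ t ∈ Set.Icc (3 / 4 : ℝ) (5 / 4),
      (∃ x, P.ratVec n x = pieceEval T k t (ratStarPoly n)) ∨
        pieceEval T k t (ratStarPoly n) = 0 := by
    intro n k t ht
    rcases h' k t ht with ⟨x, hx⟩ | h0
    · left
      refine ⟨x, ?_⟩
      rw [CStarPresentation.ratVec, ContinuousMap.ratStarPoly_eval_apply, pieceEval]
      exact congrArg (fun v => RatStarPoly.eval v (ratStarPoly n)) (funext hx)
    · right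
      simp only [pieceEval, h0, Complex.ofReal_zero]
      exact RatStarPoly.eval_zero _
  have key : ∀ (r : ℚ) (n : ℕ) (r' : ℚ), (r, n, r') ∈ P.diagram ↔ 0 < r ∧ 0 < r' ∧
      (∃ k, ∃ t ∈ Set.Icc (3 / 4 : ℝ) (5 / 4), (r : ℝ) < ‖pieceEval T k t (ratStarPoly n)‖) ∧
      ∀ k, ∀ t ∈ Set.Icc (3 / 4 : ℝ) (5 / 4), ‖pieceEval T k t (ratStarPoly n)‖ < r' := by
    intro r n r'
    simp only [CStarPresentation.diagram, Set.mem_ofPred_eq]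
    refine and_congr_right fun hr => and_congr_right fun hr' => and_congr ?_ ?_
    · rw [← not_le, ContinuousMap.norm_le _ (by exact_mod_cast hr.le)]
      push Not
      constructor
      · rintro ⟨x, hlt⟩
        obtain ⟨k, t, ht, heq⟩ := hx n x
        exact ⟨k, t, ht, heq ▸ hlt⟩
      · rintro ⟨k, t, ht, hlt⟩
        rcases hk n k t ht with ⟨x, heq⟩ | h0
        · exact ⟨x, heq ▸ hlt⟩
        -- A piece without points has polynomial value `0`, which cannot exceed the positive `r`;
        -- below, it is harmless because `r'` is positive.
        · rw [h0, norm_zero] at hlt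
          exact absurd hlt (not_lt.2 (by exact_mod_cast hr.le))
    · rw [ContinuousMap.norm_lt_iff _ (by exact_mod_cast hr')]
      constructor
      · intro hlt k t ht
        rcases hk n k t ht with ⟨x, heq⟩ | h0
        · exact heq ▸ hlt x
        · rw [h0, norm_zero]
          exact_mod_cast hr'
      · intro hlt x
        obtain ⟨k, t, ht, heq⟩ := hx n x
        exact heq ▸ hlt k t ht
  ext ⟨r, n, r'⟩
  rw [Set.mem_ofPred_eq, exists_decodeTriple_diagramEnum_iff, key]
  constructor
  · intro hmem
    obtain ⟨c, rfl⟩ := RatCode.toRat_surjective r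
    obtain ⟨c', rfl⟩ := RatCode.toRat_surjective r'
    exact ⟨(c, n, c'), rfl, (exists_diagramTest_iff T _).2 hmem⟩
  · rintro ⟨⟨c, n, c'⟩, heq, hN⟩
    obtain ⟨rfl, rfl, rfl⟩ := by simpa only [Prod.mk.injEq] using heq
    exact (exists_diagramTest_iff T _).1 hN

/-! ### The presentations of the algebra -/

theorem mem_shrinkingInterval_iff {n : ℕ} {x : ℝ} :
    x ∈ shrinkingInterval n ↔ 2 ^ n * x ∈ Set.Icc (3 / 4 : ℝ) (5 / 4) := by
  have h : (0 : ℝ) < 2 ^ n := by positivity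
  have h1 : (1 / 2 : ℝ) ^ n - (1 / 2 : ℝ) ^ (n + 2) = (3 / 4) / 2 ^ n := by
    rw [pow_add, one_div_pow]
    ring
  have h2 : (1 / 2 : ℝ) ^ n + (1 / 2 : ℝ) ^ (n + 2) = (5 / 4) / 2 ^ n := by
    rw [pow_add, one_div_pow]
    ring
  rw [shrinkingInterval, h1, h2, Set.mem_Icc, Set.mem_Icc, div_le_iff₀' h, le_div_iff₀' h]

/-- The interval of number `n` is cut out of the space by an open interval. -/
theorem mem_shrinkingInterval_of_lt {m n : ℕ} {x : ℝ} (hm : x ∈ shrinkingInterval m)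
    (h1 : 5 / 8 < 2 ^ n * x) (h2 : 2 ^ n * x < 3 / 2) : m = n := by
  obtain ⟨h3, h4⟩ := mem_shrinkingInterval_iff.1 hm
  have hx : 0 < x := by
    by_contra hx
    nlinarith [mul_nonneg (pow_nonneg (zero_le_two (α := ℝ)) n) (neg_nonneg.2 (not_lt.1 hx))]
  -- After scaling by `2 ^ n` the neighbouring intervals are `[3/2, 5/2]` and `[3/8, 5/8]`, which is
  -- where the window `(5/8, 3/2)` comes from.
  rcases lt_trichotomy m n with h | h | h
  · have : (2 : ℝ) ^ (m + 1) ≤ 2 ^ n := pow_le_pow_right₀ one_le_two h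
    rw [pow_succ] at this
    nlinarith
  · exact h
  · have : (2 : ℝ) ^ (n + 1) ≤ 2 ^ m := pow_le_pow_right₀ one_le_two h
    rw [pow_succ] at this
    nlinarith

theorem shrinkingInterval_unique {m n : ℕ} {x : ℝ} (hm : x ∈ shrinkingInterval m)
    (hn : x ∈ shrinkingInterval n) : m = n := by
  obtain ⟨h1, h2⟩ := mem_shrinkingInterval_iff.1 hn
  exact mem_shrinkingInterval_of_lt hm (by linarith) (by linarith)

theorem shrinkingInterval_mem_nhds {n : ℕ} {x : shrinkingIntervals}
    (hx : (x : ℝ) ∈ shrinkingInterval n) :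
    ∀ᶠ y : shrinkingIntervals in 𝓝 x, (y : ℝ) ∈ shrinkingInterval n := by
  obtain ⟨h1, h2⟩ := mem_shrinkingInterval_iff.1 hx
  have hc : Continuous fun y : shrinkingIntervals => 2 ^ n * (y : ℝ) := by fun_prop
  filter_upwards [hc.continuousAt.eventually (lt_mem_nhds (show 5 / 8 < 2 ^ n * (x : ℝ) by linarith)),
    hc.continuousAt.eventually (gt_mem_nhds (show 2 ^ n * (x : ℝ) < 3 / 2 by linarith))]
    with y hy1 hy2
  rcases y.2 with hy | hy
  · rw [Set.mem_singleton_iff.1 hy, mul_zero] at hy1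
    linarith
  · obtain ⟨m, hm⟩ := Set.mem_iUnion.1 hy
    rwa [← mem_shrinkingInterval_of_lt hm hy1 hy2]

theorem eq_zero_or_mem_shrinkingInterval (x : shrinkingIntervals) :
    (x : ℝ) = 0 ∨ ∃ m, (x : ℝ) ∈ shrinkingInterval m := by
  rcases x.2 with hx | hx
  · exact Or.inl hx
  · exact Or.inr (Set.mem_iUnion.1 hx)

open Classical in
/-- The function on the space that is the `j`-th generator, if the interval of number `m` is taken
as the piece of number `m + d`. -/
noncomputable def generatorFun (T : ℕ → Bool) (d j : ℕ) (x : shrinkingIntervals) : ℝ :=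
  if h : ∃ m, (x : ℝ) ∈ shrinkingInterval m then
    pieceValue T (h.choose + d) j 0 1 (2 ^ h.choose * (x : ℝ))
  -- Only the point `0` lies in no interval; it gets the common value of the pieces beyond `j`.
  else pieceValue T (j + 1) j 0 1 0

theorem generatorFun_of_mem (T : ℕ → Bool) (d j : ℕ) {x : shrinkingIntervals} {m : ℕ}
    (hx : (x : ℝ) ∈ shrinkingInterval m) :
    generatorFun T d j x = pieceValue T (m + d) j 0 1 (2 ^ m * (x : ℝ)) := by
  have h : ∃ m, (x : ℝ) ∈ shrinkingInterval m := ⟨m, hx⟩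
  rw [generatorFun, dif_pos h, shrinkingInterval_unique h.choose_spec hx]

theorem generatorFun_of_eq_zero (T : ℕ → Bool) (d j : ℕ) {x : shrinkingIntervals}
    (hx : (x : ℝ) = 0) {k : ℕ} (hk : j < k) (t : ℝ) :
    generatorFun T d j x = pieceValue T k j 0 1 t := by
  rw [generatorFun, dif_neg, pieceValue_eq_of_lt T (Nat.lt_succ_self j) hk]
  rintro ⟨m, hm⟩
  rw [mem_shrinkingInterval_iff, hx, mul_zero] at hm
  norm_num at hm

/-- Near `0` only intervals of number greater than `j` occur, where the generator is constant.
Elsewhere the intervals are open in the space. -/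
theorem continuous_generatorFun (T : ℕ → Bool) (d j : ℕ) : Continuous (generatorFun T d j) := by
  rw [continuous_iff_continuousAt]
  intro x
  rcases eq_zero_or_mem_shrinkingInterval x with hx | ⟨m, hx⟩
  · have hc : Continuous fun y : shrinkingIntervals => 2 ^ j * (y : ℝ) := by fun_prop
    have hev : ∀ᶠ y : shrinkingIntervals in 𝓝 x, 2 ^ j * (y : ℝ) < 3 / 4 :=
      hc.continuousAt.eventually (gt_mem_nhds (by simp only [hx]; norm_num))
    refine continuousAt_const.congr (f := fun _ => pieceValue T (j + 1) j 0 1 0) ?_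
    filter_upwards [hev] with y hy
    rcases eq_zero_or_mem_shrinkingInterval y with hy0 | ⟨m, hm⟩
    · rw [generatorFun_of_eq_zero T d j hy0 (Nat.lt_succ_self j)]
    · rw [generatorFun_of_mem T d j hm]
      refine pieceValue_eq_of_lt T (Nat.lt_succ_self j) ?_ _ _
      by_contra hle
      obtain ⟨h1, -⟩ := mem_shrinkingInterval_iff.1 hm
      have hp : (2 : ℝ) ^ m ≤ 2 ^ j := pow_le_pow_right₀ one_le_two (by omega)
      have hp' : (0 : ℝ) < 2 ^ m := by positivity
      have hy0 : 0 < (y : ℝ) := by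
        by_contra hneg
        nlinarith
      nlinarith
  · refine ContinuousAt.congr (f := fun y : shrinkingIntervals =>
      pieceValue T (m + d) j 0 1 (2 ^ m * (y : ℝ))) ?_ ?_
    · exact ((continuous_pieceValue T (m + d) j).comp (by fun_prop)).continuousAt
    · filter_upwards [shrinkingInterval_mem_nhds hx] with y hy
      rw [generatorFun_of_mem T d j hy]

noncomputable def generator (T : ℕ → Bool) (d j : ℕ) : C(shrinkingIntervals, ℂ) where
  toFun x := (generatorFun T d j x : ℂ)
  continuous_toFun := Complex.continuous_ofReal.comp (continuous_generatorFun T d j)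

theorem generator_apply (T : ℕ → Bool) (d j : ℕ) (x : shrinkingIntervals) :
    generator T d j x = (generatorFun T d j x : ℂ) := rfl

/-- The bound `n` is for the limit point `0`: no single piece matches it for all generators, but a
sufficiently late one does for finitely many. -/
theorem exists_generator_eq (T : ℕ → Bool) (d n : ℕ) (x : shrinkingIntervals) :
    ∃ k, d ≤ k ∧ ∃ t ∈ Set.Icc (3 / 4 : ℝ) (5 / 4),
      ∀ j ≤ n, generator T d j x = ((pieceValue T k j 0 1 t : ℝ) : ℂ) := by
  rcases eq_zero_or_mem_shrinkingInterval x with hx | ⟨m, hx⟩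
  · refine ⟨n + 1 + d, by omega, 1, by norm_num, fun j hj => ?_⟩
    rw [generator_apply, generatorFun_of_eq_zero T d j hx (show j < n + 1 + d by omega) 1]
  · exact ⟨m + d, by omega, _, mem_shrinkingInterval_iff.1 hx, fun j _ => by
      rw [generator_apply, generatorFun_of_mem T d j hx]⟩

theorem exists_point_generator_eq (T : ℕ → Bool) (d m : ℕ) {t : ℝ}
    (ht : t ∈ Set.Icc (3 / 4 : ℝ) (5 / 4)) :
    ∃ x, ∀ j, generator T d j x = ((pieceValue T (m + d) j 0 1 t : ℝ) : ℂ) := by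
  have h : 2 ^ m * (t / 2 ^ m) = t := by field_simp
  have hx : t / 2 ^ m ∈ shrinkingInterval m := mem_shrinkingInterval_iff.2 (by rwa [h])
  refine ⟨⟨t / 2 ^ m, Or.inr (Set.mem_iUnion.2 ⟨m, hx⟩)⟩, fun j => ?_⟩
  rw [generator_apply, generatorFun_of_mem T d j hx, h]

/-! ### Separation of points and density -/

theorem pieceValue_zero (T : ℕ → Bool) (k : ℕ) (t : ℝ) :
    pieceValue T k 0 0 1 t = if k = 0 then 0 else 1 := rfl

theorem pieceValue_self (T : ℕ → Bool) {k : ℕ} (hk : k ≠ 0) (t : ℝ) :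
    pieceValue T k k 0 1 t = t := by
  simp [pieceValue, hk]

theorem pieceValue_of_ne (T : ℕ → Bool) {k j : ℕ} (hk : k ≠ 0) (hj : j ≠ 0) (h : k ≠ j) (t : ℝ) :
    pieceValue T k j 0 1 t = 0 := by
  simp [pieceValue, hk, hj, h]

theorem pieceValue_zero_succ (T : ℕ → Bool) (i : ℕ) (t : ℝ) :
    pieceValue T 0 (i + 1) 0 1 t = bif T i then t else 0 := by
  simp [pieceValue]

/-- Generator `0` splits off piece `0`. Among the remaining points, generator `k ≥ 1` is nonzero
only on piece `k` and is injective there. On piece `0` the coordinate is available only through some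
`T i`, hence `hd`. -/
theorem generatorFun_injective (T : ℕ → Bool) {d : ℕ} (hd : d = 0 → ∃ i, T i = true)
    {x y : shrinkingIntervals} (h : ∀ j, generatorFun T d j x = generatorFun T d j y) : x = y := by
  have hpiece : ∀ {x y : shrinkingIntervals}, (∀ j, generatorFun T d j x = generatorFun T d j y) →
      ∀ {m}, (x : ℝ) ∈ shrinkingInterval m → m + d ≠ 0 → x = y := by
    intro x y h m hx hm
    have h1 := h (m + d)
    have h0 := h 0
    have ht := (mem_shrinkingInterval_iff.1 hx).1
    rw [generatorFun_of_mem T d _ hx, pieceValue_self T hm] at h1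
    rw [generatorFun_of_mem T d _ hx, pieceValue_zero, if_neg hm] at h0
    rcases eq_zero_or_mem_shrinkingInterval y with hy | ⟨m', hy⟩
    · rw [generatorFun_of_eq_zero T d _ hy (Nat.lt_succ_self _) 0,
        pieceValue_of_ne T (by omega) hm (by omega)] at h1
      linarith
    · have hm' : m' + d ≠ 0 := by
        intro hm'
        rw [generatorFun_of_mem T d _ hy, pieceValue_zero, if_pos hm'] at h0
        exact one_ne_zero h0
      by_cases hmm : m' = m
      · subst hmm
        rw [generatorFun_of_mem T d _ hy, pieceValue_self T hm] at h1
        exact Subtype.ext (mul_left_cancel₀ (by positivity) h1)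
      · rw [generatorFun_of_mem T d _ hy, pieceValue_of_ne T hm' hm (by omega)] at h1
        linarith
  rcases eq_zero_or_mem_shrinkingInterval x with hx | ⟨m, hx⟩
  · rcases eq_zero_or_mem_shrinkingInterval y with hy | ⟨m', hy⟩
    · exact Subtype.ext (hx.trans hy.symm)
    · refine (hpiece (fun j => (h j).symm) hy fun hm => ?_).symm
      have h0 := h 0
      rw [generatorFun_of_mem T d _ hy, generatorFun_of_eq_zero T d _ hx one_pos 0,
        pieceValue_zero, pieceValue_zero, if_pos hm, if_neg one_ne_zero] at h0
      exact one_ne_zero h0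
  · by_cases hm : m + d = 0
    · obtain ⟨rfl, rfl⟩ : m = 0 ∧ d = 0 := by omega
      rcases eq_zero_or_mem_shrinkingInterval y with hy | ⟨m', hy⟩
      · have h0 := h 0
        rw [generatorFun_of_mem T 0 _ hx, generatorFun_of_eq_zero T 0 _ hy one_pos 0,
          pieceValue_zero, pieceValue_zero, if_pos hm, if_neg one_ne_zero] at h0
        exact absurd h0.symm one_ne_zero
      · by_cases hm' : m' = 0
        · subst hm'
          obtain ⟨i, hi⟩ := hd rfl
          have h1 := h (i + 1)
          rw [generatorFun_of_mem T 0 _ hx, generatorFun_of_mem T 0 _ hy, add_zero,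
            pieceValue_zero_succ, pieceValue_zero_succ, hi] at h1
          exact Subtype.ext (mul_left_cancel₀ (by positivity) h1)
        · exact (hpiece (fun j => (h j).symm) hy hm').symm
    · exact hpiece h hx hm

/-- A nonunital subalgebra with an element at distance less than one to the unit has the unit in
its closure. -/
theorem NonUnitalStarSubalgebra.one_mem_closure {A : Type*} [CStarAlgebra A]
    (B : NonUnitalStarSubalgebra ℂ A) {b : A} (hb : b ∈ B) (h : ‖1 - b‖ < 1) :
    (1 : A) ∈ closure (B : Set A) := by
  -- These are polynomials in `b` without constant term, and they converge to the unit
  -- geometrically.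
  have hmem : ∀ n : ℕ, 1 - (1 - b) ^ n ∈ B := by
    intro n
    induction n with
    | zero => simp
    | succ n ih =>
      have heq : 1 - (1 - b) ^ (n + 1) = (1 - (1 - b) ^ n) + b - (1 - (1 - b) ^ n) * b := by
        rw [pow_succ]
        noncomm_ring
      rw [heq]
      exact sub_mem (add_mem ih hb) (mul_mem ih hb)
  have hlim : Tendsto (fun n : ℕ => 1 - (1 - b) ^ n) atTop (𝓝 (1 - 0)) :=
    tendsto_const_nhds.sub (tendsto_pow_atTop_nhds_zero_of_norm_lt_one h)
  rw [sub_zero] at hlim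
  exact mem_closure_of_tendsto hlim (Eventually.of_forall hmem)

/-- Once the closure contains the unit it is a unital star subalgebra, and Stone–Weierstrass
applies. -/
theorem ContinuousMap.dense_of_separatesPoints {X : Type*} [TopologicalSpace X] [CompactSpace X]
    (B : NonUnitalStarSubalgebra ℂ C(X, ℂ)) (h1 : (1 : C(X, ℂ)) ∈ closure (B : Set C(X, ℂ)))
    (hB : ∀ x y : X, x ≠ y → ∃ f ∈ B, f x ≠ f y) : Dense (B : Set C(X, ℂ)) := by
  let S : StarSubalgebra ℂ C(X, ℂ) :=
    { B.topologicalClosure with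
      one_mem' := h1
      algebraMap_mem' := fun c => by
        rw [Algebra.algebraMap_eq_smul_one]
        exact B.topologicalClosure.smul_mem' c h1 }
  have hS : (S : Set C(X, ℂ)) = closure (B : Set C(X, ℂ)) := rfl
  have htop := ContinuousMap.starSubalgebra_topologicalClosure_eq_top_of_separatesPoints S
    fun x y hxy => by
      obtain ⟨f, hf, hne⟩ := hB x y hxy
      exact ⟨f, ⟨f, subset_closure hf, rfl⟩, hne⟩
  have hcl : closure (S : Set C(X, ℂ)) = Set.univ := by
    rw [← StarSubalgebra.topologicalClosure_coe, htop]
    rfl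
  rw [hS, closure_closure] at hcl
  exact dense_iff_closure_eq.2 hcl

theorem dense_adjoin_generator (T : ℕ → Bool) {d : ℕ} (hd : d = 0 → ∃ i, T i = true) :
    Dense (NonUnitalStarAlgebra.adjoin ℂ (Set.range (generator T d)) :
      Set C(shrinkingIntervals, ℂ)) := by
  have hgen : ∀ j, generator T d j ∈ NonUnitalStarAlgebra.adjoin ℂ (Set.range (generator T d)) :=
    fun j => NonUnitalStarAlgebra.subset_adjoin ℂ _ (Set.mem_range_self j)
  refine ContinuousMap.dense_of_separatesPoints _ ?_ fun x y hxy => ?_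
  · rcases Nat.eq_zero_or_pos d with h0 | hpos
    · obtain ⟨i, hi⟩ := hd h0
      refine NonUnitalStarSubalgebra.one_mem_closure _
        -- Here `1 - b` is the product of `1 - u_0` and `1 - u_(i+1)`: it is `0` off piece `0`, and
        -- `1 - t` with `|1 - t| ≤ 1/4` on it.
        (b := generator T d 0 + generator T d (i + 1) - generator T d 0 * generator T d (i + 1))
        (sub_mem (add_mem (hgen _) (hgen _)) (mul_mem (hgen _) (hgen _))) ?_
      rw [ContinuousMap.norm_lt_iff _ one_pos]
      intro x
      obtain ⟨k, -, t, ht, hk⟩ := exists_generator_eq T d (i + 1) x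
      rw [ContinuousMap.sub_apply, ContinuousMap.sub_apply, ContinuousMap.add_apply,
        ContinuousMap.mul_apply, ContinuousMap.one_apply, hk 0 (by omega), hk (i + 1) le_rfl,
        pieceValue_zero]
      split_ifs with hk0
      · rw [hk0, pieceValue_zero_succ, hi, cond_true, ← Complex.ofReal_add, ← Complex.ofReal_mul,
          ← Complex.ofReal_sub, ← Complex.ofReal_one, ← Complex.ofReal_sub, Complex.norm_real,
          Real.norm_eq_abs, abs_lt]
        constructor <;> linarith [ht.1, ht.2]
      · simp
    · refine subset_closure ?_
      have h1 : generator T d 0 = 1 := by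
        ext x
        obtain ⟨k, hk, t, -, heq⟩ := exists_generator_eq T d 0 x
        rw [heq 0 le_rfl, pieceValue_zero, if_neg (by omega)]
        simp
      exact h1 ▸ hgen 0
  · by_contra hcon
    push Not at hcon
    refine hxy (generatorFun_injective T hd fun j => ?_)
    exact Complex.ofReal_injective (hcon _ (hgen j))

/-- The presentation of the algebra by the functions `generator T d`. -/
noncomputable def piecePresentation (T : ℕ → Bool) {d : ℕ} (hd : d = 0 → ∃ i, T i = true) :
    CStarPresentation C(shrinkingIntervals, ℂ) where
  vec := generator T d
  dense_adjoin := dense_adjoin_generator T hd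

/-- With `d = 1` the space has no piece `0`, but `diagramEnum T` still tests it. This is harmless
because all generators are zero there when `T` is false. -/
theorem isName_piecePresentation (T : ℕ → Bool) {d : ℕ} (hd : d = 0 → ∃ i, T i = true)
    (hd' : d = 0 ∨ d = 1 ∧ ∀ i, T i = false) :
    (piecePresentation T hd).IsName (diagramEnum T) := by
  refine isName_diagramEnum _ T (fun n x => ?_) fun k t ht => ?_
  · obtain ⟨k, -, h⟩ := exists_generator_eq T d n x
    exact ⟨k, h⟩
  · rcases Nat.lt_or_ge k d with hk | hk
    · right
      obtain ⟨rfl, hT⟩ : d = 1 ∧ ∀ i, T i = false := hd'.resolve_left (by omega)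
      obtain rfl : k = 0 := by omega
      rintro (_ | i)
      · rfl
      · rw [pieceValue_zero_succ, hT, cond_false]
    · left
      obtain ⟨m, rfl⟩ := Nat.exists_eq_add_of_le' hk
      exact exists_point_generator_eq T d m ht

/-- If the generators that occur in a rational vector vanish on the piece `0`, then the vector is
not close to the unit. -/
theorem one_le_norm_ratVec_sub_one (T : ℕ → Bool) (hd : (0 : ℕ) = 0 → ∃ i, T i = true) {n : ℕ}
    (hT : ∀ i < n, T i = false) : 1 ≤ ‖(piecePresentation T hd).ratVec n - 1‖ := by
  obtain ⟨x, hx⟩ := exists_point_generator_eq T 0 0 (t := 1) (by norm_num)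
  have h0 : (piecePresentation T hd).ratVec n x = 0 := by
    rw [CStarPresentation.ratVec, ContinuousMap.ratStarPoly_eval_apply,
      ← RatStarPoly.eval_zero (A := ℂ) (ratStarPoly n)]
    refine RatStarPoly.eval_congr (n := n) (fun j hj => ?_) fun m hm => index_le_of_mem_ratStarPoly hm
    refine (hx j).trans ?_
    rcases j with _ | i
    · simp [pieceValue_zero]
    -- Indices at most `n` involve only `T i` with `i + 1 ≤ n`, so falsity strictly below `n`
    -- suffices.
    · rw [add_zero, pieceValue_zero_succ, hT i (by omega), cond_false, Complex.ofReal_zero]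
  refine le_trans ?_ (ContinuousMap.norm_coe_le_norm _ x)
  rw [ContinuousMap.sub_apply, h0]
  simp

/-! ### The theorem -/

open Nat.Partrec (Code)

/-- The test whether, within `i` steps, the program `c` on input `e` gives a program that on
input `1` gives a number `n ≤ i`. -/
def haltTest (c e : Code) (i : ℕ) : Bool :=
  ((((c.evaln i (Encodable.encode e)).bind fun y =>
    (Denumerable.ofNat Code y).evaln i 1).map fun n => decide (n ≤ i)).getD false)

theorem primrec_haltTest (c : Code) : Primrec₂ (haltTest c) := by
  have h1 : Primrec fun x : Code × ℕ => c.evaln x.2 (Encodable.encode x.1) :=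
    Code.primrec_evaln.comp ((Primrec.snd.pair (Primrec.const c)).pair
      (Primrec.encode.comp Primrec.fst))
  have h2 : Primrec₂ fun (x : Code × ℕ) (y : ℕ) => (Denumerable.ofNat Code y).evaln x.2 1 :=
    Code.primrec_evaln.comp (((Primrec.snd.comp Primrec.fst).pair
      ((Primrec.ofNat Code).comp Primrec.snd)).pair (Primrec.const 1))
  have h3 : Primrec₂ fun (x : Code × ℕ) (n : ℕ) => decide (n ≤ x.2) :=
    Primrec.nat_le.decide.comp Primrec.snd (Primrec.snd.comp Primrec.fst)
  exact Primrec.option_getD.comp (Primrec.option_map (Primrec.option_bind h1 h2) h3)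
    (Primrec.const false)

theorem haltTest_eq_true_iff {c e : Code} {i : ℕ} : haltTest c e i = true ↔
    ∃ y ∈ c.evaln i (Encodable.encode e), ∃ n ∈ (Denumerable.ofNat Code y).evaln i 1, n ≤ i := by
  unfold haltTest
  rcases c.evaln i (Encodable.encode e) with _ | y
  · simp
  · rcases h : (Denumerable.ofNat Code y).evaln i 1 with _ | n <;> simp [h]

theorem computablyPresentable_shrinkingIntervals :
    ComputablyPresentable C(shrinkingIntervals, ℂ) := by
  have hT : Primrec₂ fun (_ : Unit) (_ : ℕ) => false := Primrec.const _
  refine ⟨piecePresentation (fun _ => false) (d := 1) (by simp), diagramEnum fun _ => false, ?_,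
    isName_piecePresentation _ _ (Or.inr ⟨rfl, fun _ => rfl⟩)⟩
  exact ((primrec_diagramEnum hT).comp (Primrec.const ()) Primrec.id).to_comp

theorem not_uniformlyComputablyUnital_shrinkingIntervals :
    ¬ UniformlyComputablyUnital C(shrinkingIntervals, ℂ) := by
  rintro ⟨ψ, hψ, h⟩
  obtain ⟨c, hc⟩ := Code.exists_code.1 hψ
  have heval : ∀ e i, i ∈ ψ e → Encodable.encode i ∈ c.eval (Encodable.encode e) := by
    intro e i hi
    rw [hc]
    simpa using hi
  -- The recursion theorem gives a program that enumerates the diagram for the test that watches `ψ`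
  -- on that very program.
  obtain ⟨e, he⟩ := Code.fixed_point₂
    (f := fun e m => Part.some (diagramEnum (haltTest c e) m))
    (primrec_diagramEnum (primrec_haltTest c)).to_comp.partrec₂
  have hindex : ∀ P : CStarPresentation C(shrinkingIntervals, ℂ),
      P.IsName (diagramEnum (haltTest c e)) → P.IsIndex e :=
    fun P hP => ⟨_, fun m => by rw [he], hP⟩
  have hhalt : ∀ {i n}, i ∈ ψ e → n ∈ i.eval 1 →
      (∃ k, haltTest c e k = true) ∧ ∀ k < n, haltTest c e k = false := by
    intro i n hi hn
    constructor
    · obtain ⟨k₁, hk₁⟩ := Code.evaln_complete.1 (heval e i hi)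
      obtain ⟨k₂, hk₂⟩ := Code.evaln_complete.1 hn
      -- The stage has to cover both running times and also reach `n`.
      refine ⟨max n (max k₁ k₂), haltTest_eq_true_iff.2
        ⟨_, Code.evaln_mono (by simp) hk₁, n, ?_, le_max_left _ _⟩⟩
      rw [Denumerable.ofNat_encode]
      exact Code.evaln_mono (by simp) hk₂
    · intro k hk
      by_contra hne
      obtain ⟨y, hy, n', hn', hle⟩ := haltTest_eq_true_iff.1 (Bool.eq_true_of_not_eq_false hne)
      obtain rfl := Part.mem_unique (Code.evaln_sound hy) (heval e i hi)
      rw [Denumerable.ofNat_encode] at hn'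
      have := Part.mem_unique (Code.evaln_sound hn') hn
      omega
  -- The case decides which presentation `e` is an index of: `d = 0` if the test ever succeeds, `d =
  -- 1` otherwise.
  by_cases hex : ∃ k, haltTest c e k = true
  · obtain ⟨i, hi, hvec⟩ := h (piecePresentation (haltTest c e) (d := 0) fun _ => hex) e
      (hindex _ (isName_piecePresentation _ _ (Or.inl rfl)))
    obtain ⟨n, hn, hlt⟩ := hvec 1
    have := one_le_norm_ratVec_sub_one (haltTest c e) (fun _ => hex) (hhalt hi hn).2
    norm_num at hlt
    linarith
  · obtain ⟨i, hi, hvec⟩ := h (piecePresentation (haltTest c e) (d := 1) (by simp)) e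
      (hindex _ (isName_piecePresentation _ _
        (Or.inr ⟨rfl, fun k => by simpa using not_exists.1 hex k⟩)))
    obtain ⟨n, hn, -⟩ := hvec 1
    exact hex (hhalt hi hn).1

theorem theorem5p3 :
    ComputablyPresentable C(shrinkingIntervals, ℂ) ∧
      ¬ UniformlyComputablyUnital C(shrinkingIntervals, ℂ) :=
  ⟨computablyPresentable_shrinkingIntervals, not_uniformlyComputablyUnital_shrinkingIntervals⟩
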